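/- Let $0<\alpha<1$, $0<\varphi_0<\pi/2$, $\varepsilon>0$. Let $K(\varphi_0)=\{\zeta\in\mathbb{C}\setminus\{0\}:|\arg\zeta|<\varphi_0\}$, $-\overline{K(\varphi_0)}=\{z\in\mathbb{C}:-z\in\overline{K(\varphi_0)}\}$, and let $E_\alpha(z)=\sum_{k=0}^{\infty}\frac{z^k}{\Gamma(\alpha k+1)}$ be the Mittag-Leffler function. For integers $1\le j\le n$ put $$b_{jn}=\int_{j-1}^{j}\frac{dx}{x^{1-\alpha}(n-x)^{\alpha}},$$ and for $n\ge 1$ put $$a_{0n}=-\frac{\alpha}{\Gamma(1-\alpha)}\,b_{1n},\qquad a_{nn}=\frac{\alpha}{\Gamma(1-\alpha)}\,\frac{b_{nn}}{n^\alpha-(n-1)^\alpha},$$ $$a_{jn}=\frac{\alpha}{\Gamma(1-\alpha)}\left(\frac{b_{jn}}{j^\alpha-(j-1)^\alpha}-\frac{b_{j+1,n}}{(j+1)^\alpha-j^\alpha}\right)\quad(1\le j\le n-1).$$ Let $s(\alpha)=\alpha$ if $\alpha<1/2$ and $s(\alpha)=1-\alpha-\varepsilon$ if $\alpha\ge 1/2$.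 Then there is a constant $C>0$, depending only on $\alpha$, $\varepsilon$ and $\varphi_0$, such that the following holds for all $T>0$, all integers $N\ge1$ and all $\lambda\in-\overline{K(\varphi_0)}$. Put $\Delta t=T/N$ and $t_n=n\Delta t$, and let $v_0,\dots,v_N\in\mathbb{C}$ solve the difference scheme for the Cauchy problem $\partial^\alpha v=\lambda v$, $v(0)=1$, with Caputo derivative $\partial^\alpha$, that is, $$\sum_{j=0}^{n}\frac{a_{jn}v_j}{(\Delta t)^\alpha}-\lambda v_n=0\quad(1\le n\le N),\qquad v_0=1.$$ Then $$|v_n-E_\alpha(\lambda t_n^\alpha)|\le\frac{C\,|\lambda|(\Delta t)^\alpha\bigl(1+|\lambda|(\Delta t)^\alpha\bigr)}{n^{s(\alpha)}},\qquad 1\le n\le N.$$ -/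

import Mathlib

/-- The open sector `K(φ)` of the nonzero complex numbers with `|arg ζ| < φ`. -/
def openSector (φ : ℝ) : Set ℂ := {ζ : ℂ | ζ ≠ 0 ∧ |Complex.arg ζ| < φ}

/-- The closed sector `-closure K(φ)` about the negative real half-axis. -/
def negClosedSector (φ : ℝ) : Set ℂ := {z : ℂ | -z ∈ closure (openSector φ)}

/-- The Mittag-Leffler function `E_α(z) = ∑ z ^ k / Γ(α k + 1)`, whose series converges for
every complex `z` when `α > 0`. -/
noncomputable def mittagLeffler (α : ℝ) (z : ℂ) : ℂ :=
  ∑' k : ℕ, z ^ k / ((Real.Gamma (α * (k : ℝ) + 1) : ℝ) : ℂ)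

/-- The weights `b_{jn} = ∫_{j-1}^{j} dx / (x ^ (1 - α) (n - x) ^ α)`, for `1 ≤ j ≤ n`. -/
noncomputable def quadWeight (α : ℝ) (j n : ℕ) : ℝ :=
  ∫ x in ((j : ℝ) - 1)..(j : ℝ), 1 / (x ^ (1 - α) * ((n : ℝ) - x) ^ α)

/-- The coefficients `a_{jn}`, for `0 ≤ j ≤ n` and `1 ≤ n`, obtained by collecting the factors of
`v j` in `α / Γ(1 - α) * ∑_{j = 1}^{n} b_{jn} (v j - v (j - 1)) / (j ^ α - (j - 1) ^ α)`. -/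
noncomputable def schemeCoeff (α : ℝ) (j n : ℕ) : ℝ :=
  if j = 0 then -(α / Real.Gamma (1 - α) * quadWeight α 1 n)
  else if j < n then
    α / Real.Gamma (1 - α) *
      (quadWeight α j n / ((j : ℝ) ^ α - ((j : ℝ) - 1) ^ α) -
        quadWeight α (j + 1) n / (((j : ℝ) + 1) ^ α - (j : ℝ) ^ α))
  else
    α / Real.Gamma (1 - α) * (quadWeight α n n / ((n : ℝ) ^ α - ((n : ℝ) - 1) ^ α))

/-- `v 0, …, v N` solves the difference scheme with step `Δt` for `∂^α v = lam * v`, `v(0) = 1`.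
Values of `v` beyond the index `N` are not constrained. -/
def IsSchemeSolution (α Δt : ℝ) (N : ℕ) (lam : ℂ) (v : ℕ → ℂ) : Prop :=
  v 0 = 1 ∧
    ∀ n : ℕ, 1 ≤ n → n ≤ N →
      (∑ j ∈ Finset.range (n + 1),
        ((schemeCoeff α j n : ℝ) : ℂ) * v j / ((Δt ^ α : ℝ) : ℂ)) - lam * v n = 0

/-- The exponent `s(α)`: it is `α` for `α < 1/2` and `1 - α - ε` for `α ≥ 1/2`. -/
noncomputable def rateExponent (α ε : ℝ) : ℝ :=
  if α < 1 / 2 then α else 1 - α - ε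

/-!
The scheme is analysed by a maximum principle instead of a transform. In unit steps, with
`μ = lam * Δt ^ α`, it reads `D v = Γ(1 - α) μ v`, where
`D g n = ∑ i < n, cellMean α i n • (g (i + 1) - g i)` and `cellMean α i n` is a mean of
`(n - x) ^ (-α)` over `[i, i + 1]`. These means increase with `i`, so `D` is an M-matrix whose rows
sum to zero. Hence, when `Re μ ≤ 0`, the modulus of a complex solution is dominated by any real
barrier for the equation with `Re μ` in place of `μ` (`norm_le_of_barrier`).

Let `q = min α (1 - α)`, which is at least the exponent in the theorem. With `κ` the size of the
negative real coefficient, `min (κ n ^ (α - q)) (n ^ (-q))` is, up to constants, a barrier for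
residuals of size `κ n ^ (-q)` (`exists_barrier`): its first member is increasing, and the second
is in force only for `κ n ^ α ≳ 1`, where the zeroth-order term outweighs its discrete derivative.
So a residual `K |Re μ| n ^ (-q)` causes an error `O(K n ^ (-q))`, uniformly in `μ`
(`exists_norm_le_of_residual`).

The function `E_α(μ x ^ α)` solves the continuous equation (`integral_deriv_mittagLeffler`), and
its interpolant linear in `x ^ α` has truncation error `O(sup |E_α''| |μ| ^ 2 n ^ (-q))`
(`exists_norm_truncation_le`). As `|μ| = O(|Re μ|)` on the sector, the theorem follows once `E_α''`
is bounded there. That bound is obtained from the scheme as well: refining the grid for a fixed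
argument shows `|E_α| ≤ 1` on the open left half-plane (`norm_mittagLeffler_le_one`), and Cauchy's
estimate on discs inside it, which exist because `φ₀ < π / 2`, bounds the second derivative.
-/

/-! ### The Mittag-Leffler function is entire -/

lemma rpow_mul_exp_neg_le_Gamma {R x : ℝ} (hR : 0 < R) (hx : 0 ≤ x) :
    R ^ x * Real.exp (-R) ≤ Real.Gamma (x + 1) := by
  have hint := Real.GammaIntegral_convergent (s := x + 1) (by linarith)
  rw [Real.Gamma_eq_integral (by linarith), ← integral_exp_neg_Ioi R,
    ← MeasureTheory.integral_const_mul]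
  refine le_trans ?_ (MeasureTheory.setIntegral_mono_set hint ?_
    (Filter.Eventually.of_forall (Set.Ioi_subset_Ioi hR.le)))
  · refine MeasureTheory.setIntegral_mono_on ((integrableOn_exp_neg_Ioi R).const_mul _)
      (hint.mono_set (Set.Ioi_subset_Ioi hR.le)) measurableSet_Ioi fun t ht => ?_
    rw [mul_comm, add_sub_cancel_right]
    have ht' : R < t := ht
    gcongr
  · filter_upwards [MeasureTheory.self_mem_ae_restrict measurableSet_Ioi] with t ht
    have ht' : 0 < t := ht
    simp only [Pi.zero_apply]
    positivity

lemma summable_pow_div_Gamma {α : ℝ} (hα : 0 < α) {r : ℝ} (hr : 0 ≤ r) :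
    Summable fun k : ℕ => r ^ k / Real.Gamma (α * k + 1) := by
  -- `R ^ α = 2 (r + 1)`, so that the comparison series is geometric of ratio below `1 / 2`.
  set R : ℝ := (2 * (r + 1)) ^ (α⁻¹) with hRdef
  have hR : 0 < R := by positivity
  have hRα : R ^ α = 2 * (r + 1) := by
    rw [hRdef, ← Real.rpow_mul (by positivity), inv_mul_cancel₀ hα.ne', Real.rpow_one]
  have hgeom : Summable fun k : ℕ => Real.exp R * (r / (2 * (r + 1))) ^ k := by
    refine (summable_geometric_of_lt_one (by positivity) ?_).mul_left _
    rw [div_lt_one (by positivity)]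
    linarith
  refine hgeom.of_nonneg_of_le (fun k => ?_) (fun k => ?_)
  · exact div_nonneg (pow_nonneg hr k) (Real.Gamma_pos_of_pos (by positivity)).le
  · have h := rpow_mul_exp_neg_le_Gamma (x := α * k) hR (by positivity)
    rw [Real.rpow_mul hR.le, hRα, Real.rpow_natCast] at h
    calc r ^ k / Real.Gamma (α * k + 1) ≤ r ^ k / ((2 * (r + 1)) ^ k * Real.exp (-R)) := by
          gcongr
      _ = Real.exp R * (r / (2 * (r + 1))) ^ k := by
          rw [Real.exp_neg, div_pow]
          field_simp

lemma norm_mittagLeffler_term_le {α : ℝ} (hα : 0 < α) (k : ℕ) {r : ℝ} {w : ℂ} (hw : ‖w‖ ≤ r) :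
    ‖w ^ k / ((Real.Gamma (α * (k : ℝ) + 1) : ℝ) : ℂ)‖ ≤ r ^ k / Real.Gamma (α * k + 1) := by
  have hpos : 0 < Real.Gamma (α * k + 1) := Real.Gamma_pos_of_pos (by positivity)
  rw [norm_div, norm_pow, Complex.norm_of_nonneg hpos.le]
  gcongr

lemma hasSum_mittagLeffler {α : ℝ} (hα : 0 < α) (z : ℂ) :
    HasSum (fun k : ℕ => z ^ k / ((Real.Gamma (α * (k : ℝ) + 1) : ℝ) : ℂ))
      (mittagLeffler α z) :=
  (Summable.of_norm_bounded (summable_pow_div_Gamma hα (norm_nonneg z))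
    fun k => norm_mittagLeffler_term_le hα k le_rfl).hasSum

lemma mittagLeffler_zero (α : ℝ) : mittagLeffler α 0 = 1 := by
  rw [mittagLeffler, tsum_eq_single 0]
  · simp
  · intro k hk
    simp [hk]

lemma differentiable_mittagLeffler {α : ℝ} (hα : 0 < α) :
    Differentiable ℂ (mittagLeffler α) := by
  intro z
  have h := Complex.differentiableOn_tsum_of_summable_norm (U := Metric.ball (0 : ℂ) (‖z‖ + 1))
    (F := fun (k : ℕ) (w : ℂ) => w ^ k / ((Real.Gamma (α * (k : ℝ) + 1) : ℝ) : ℂ))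
    (summable_pow_div_Gamma hα (add_nonneg (norm_nonneg z) zero_le_one))
    (fun i => by fun_prop) Metric.isOpen_ball
    (fun i w hw => norm_mittagLeffler_term_le hα i (mem_ball_zero_iff.1 hw).le)
  exact h.differentiableAt (Metric.isOpen_ball.mem_nhds (by simp))

lemma hasSum_deriv_mittagLeffler {α : ℝ} (hα : 0 < α) (z : ℂ) :
    HasSum (fun k : ℕ => (k : ℂ) * z ^ (k - 1) / ((Real.Gamma (α * (k : ℝ) + 1) : ℝ) : ℂ))
      (deriv (mittagLeffler α) z) := by
  have h := Complex.hasSum_deriv_of_summable_norm (U := Metric.ball (0 : ℂ) (‖z‖ + 1)) (z := z)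
    (F := fun (k : ℕ) (w : ℂ) => w ^ k / ((Real.Gamma (α * (k : ℝ) + 1) : ℝ) : ℂ))
    (summable_pow_div_Gamma hα (add_nonneg (norm_nonneg z) zero_le_one))
    (fun i => by fun_prop) Metric.isOpen_ball
    (fun i w hw => norm_mittagLeffler_term_le hα i (mem_ball_zero_iff.1 hw).le) (by simp)
  simpa using! h

/-! ### The weakly singular kernel on a grid cell -/

lemma intervalIntegrable_rpow_mul_sub_rpow {s t a : ℝ} (hs : -1 < s) (ht : -1 < t) (ha : 0 < a) :
    IntervalIntegrable (fun x : ℝ => x ^ s * (a - x) ^ t) MeasureTheory.volume 0 a := by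
  refine IntervalIntegrable.trans (b := a / 2) ?_ ?_
  · refine (intervalIntegral.intervalIntegrable_rpow' hs).mul_continuousOn ?_
    rw [Set.uIcc_of_le (by linarith)]
    exact ContinuousOn.rpow_const (by fun_prop) fun x hx => Or.inl (by linarith [hx.2])
  · have h : IntervalIntegrable (fun x : ℝ => (a - x) ^ t) MeasureTheory.volume (a / 2) a := by
      have h0 := (intervalIntegral.intervalIntegrable_rpow' (a := a / 2) (b := 0) ht).comp_sub_left a
      have h2 : a - a / 2 = a / 2 := by ring
      simpa [h2] using h0
    refine h.continuousOn_mul ?_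
    rw [Set.uIcc_of_le (by linarith)]
    exact ContinuousOn.rpow_const (by fun_prop) fun x hx => Or.inl (by linarith [hx.1])

lemma integral_rpow_mul_sub_rpow {s t a : ℝ} (hs : 0 < s) (ht : 0 < t) (ha : 0 < a) :
    ∫ x in (0 : ℝ)..a, x ^ (s - 1) * (a - x) ^ (t - 1) =
      a ^ (s + t - 1) * (Real.Gamma s * Real.Gamma t / Real.Gamma (s + t)) := by
  have h := Complex.betaIntegral_scaled (s : ℂ) (t : ℂ) ha
  rw [Complex.betaIntegral_eq_Gamma_mul_div _ _ (by simpa) (by simpa)] at h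
  have h1 : ∫ x in (0 : ℝ)..a, (x : ℂ) ^ ((s : ℂ) - 1) * ((a : ℂ) - x) ^ ((t : ℂ) - 1) =
      ((∫ x in (0 : ℝ)..a, x ^ (s - 1) * (a - x) ^ (t - 1) : ℝ) : ℂ) := by
    rw [← intervalIntegral.integral_ofReal]
    refine intervalIntegral.integral_congr fun x hx => ?_
    rw [Set.uIcc_of_le ha.le] at hx
    have h2 : 0 ≤ a - x := by linarith [hx.2]
    push_cast [Complex.ofReal_cpow hx.1, Complex.ofReal_cpow h2]
    rfl
  rw [h1, ← Complex.ofReal_add, Complex.Gamma_ofReal, Complex.Gamma_ofReal, Complex.Gamma_ofReal,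
    ← Complex.ofReal_one, ← Complex.ofReal_sub, ← Complex.ofReal_cpow ha.le] at h
  exact_mod_cast h

/-- The increment of `x ^ α` over the cell `[i, i + 1]`. -/
noncomputable def powStep (α : ℝ) (i : ℕ) : ℝ := ((i : ℝ) + 1) ^ α - (i : ℝ) ^ α

/-- The mean of `(n - x) ^ (-α)` over the cell `[i, i + 1]` with respect to the measure
`d(x ^ α)`. Cells are numbered by their left end point, so `i < n` is the relevant range. -/
noncomputable def cellMean (α : ℝ) (i n : ℕ) : ℝ := α * quadWeight α (i + 1) n / powStep α i

section
variable {α : ℝ}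

lemma powStep_pos (hα : 0 < α) (i : ℕ) : 0 < powStep α i :=
  sub_pos.2 (Real.rpow_lt_rpow (by positivity) (by linarith) hα)

lemma powStep_le (hα1 : α ≤ 1) (i : ℕ) : powStep α i ≤ ((i : ℝ) + 1) ^ (α - 1) := by
  have hi : (0 : ℝ) ≤ i := by positivity
  have h : (i : ℝ) * ((i : ℝ) + 1) ^ (α - 1) ≤ (i : ℝ) ^ α := by
    rcases eq_or_lt_of_le hi with h0 | h0
    · rw [← h0, zero_mul]
      positivity
    · calc (i : ℝ) * ((i : ℝ) + 1) ^ (α - 1) ≤ (i : ℝ) * (i : ℝ) ^ (α - 1) := by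
            gcongr ?_ * ?_
            exact Real.rpow_le_rpow_of_nonpos h0 (by linarith) (by linarith)
        _ = (i : ℝ) ^ α := by
            rw [Real.rpow_sub_one h0.ne']
            field_simp
  have h2 : ((i : ℝ) + 1) ^ α = ((i : ℝ) + 1) * ((i : ℝ) + 1) ^ (α - 1) := by
    rw [Real.rpow_sub_one (by positivity)]
    field_simp
  rw [powStep, h2]
  linarith

lemma integral_rpow_cell (hα : 0 < α) (i : ℕ) :
    ∫ x in (i : ℝ)..(i + 1), α * x ^ (α - 1) = powStep α i := by
  rw [intervalIntegral.integral_const_mul, integral_rpow (Or.inl (by linarith)),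
    sub_add_cancel, powStep]
  field_simp

lemma le_powStep (hα : 0 < α) (hα1 : α ≤ 1) (i : ℕ) :
    α * ((i : ℝ) + 1) ^ (α - 1) ≤ powStep α i := by
  rw [← integral_rpow_cell hα i]
  have h := intervalIntegral.integral_mono_on_of_le_Ioo (a := (i : ℝ)) (b := i + 1)
    (f := fun _ => α * ((i : ℝ) + 1) ^ (α - 1)) (g := fun x => α * x ^ (α - 1)) (by linarith)
    (by simp) ((intervalIntegral.intervalIntegrable_rpow' (by linarith)).const_mul _)
    (fun x hx => ?_)
  · simpa using h
  · have h0 : (0 : ℝ) < x := lt_of_le_of_lt (by positivity) hx.1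
    exact mul_le_mul_of_nonneg_left
      (Real.rpow_le_rpow_of_nonpos h0 hx.2.le (by linarith)) hα.le

lemma quadWeight_eq {i n : ℕ} (hin : i < n) :
    quadWeight α (i + 1) n = ∫ x in (i : ℝ)..(i + 1), x ^ (α - 1) * ((n : ℝ) - x) ^ (-α) := by
  have h : (i : ℝ) + 1 ≤ n := by exact_mod_cast hin
  rw [quadWeight]
  push_cast
  rw [add_sub_cancel_right]
  refine intervalIntegral.integral_congr fun x hx => ?_
  rw [Set.uIcc_of_le (by linarith)] at hx
  have h0 : (0 : ℝ) ≤ x := le_trans (by positivity) hx.1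
  have h2 : 0 ≤ (n : ℝ) - x := by linarith [hx.2]
  rw [Real.rpow_neg h2, show α - 1 = -(1 - α) by ring, Real.rpow_neg h0, one_div, mul_inv]

lemma intervalIntegrable_kernel_cell {s : ℝ} (hs : -1 < s) (hα1 : α < 1) {i n : ℕ} (hin : i < n) :
    IntervalIntegrable (fun x : ℝ => x ^ s * ((n : ℝ) - x) ^ (-α)) MeasureTheory.volume
      (i : ℝ) (i + 1) := by
  have h : (i : ℝ) + 1 ≤ n := by exact_mod_cast hin
  have hi : (0 : ℝ) ≤ i := by positivity
  refine (intervalIntegrable_rpow_mul_sub_rpow hs (by linarith : -1 < -α)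
    (by linarith : (0 : ℝ) < n)).mono_set ?_
  rw [Set.uIcc_of_le (by linarith), Set.uIcc_of_le (by linarith)]
  exact Set.Icc_subset_Icc hi h

lemma integral_kernel_cell (hα : 0 < α) {i n : ℕ} (hin : i < n) :
    ∫ x in (i : ℝ)..(i + 1), α * x ^ (α - 1) * ((n : ℝ) - x) ^ (-α) =
      powStep α i * cellMean α i n := by
  simp only [mul_assoc]
  rw [intervalIntegral.integral_const_mul, ← quadWeight_eq hin, cellMean,
    mul_div_cancel₀ _ (powStep_pos hα i).ne']

lemma le_cellMean (hα : 0 < α) (hα1 : α < 1) {i n : ℕ} (hin : i < n) :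
    ((n : ℝ) - i) ^ (-α) ≤ cellMean α i n := by
  have h : (i : ℝ) + 1 ≤ n := by exact_mod_cast hin
  have hi : (0 : ℝ) ≤ i := by positivity
  rw [cellMean, le_div_iff₀ (powStep_pos hα i), quadWeight_eq hin, ← integral_rpow_cell hα i,
    ← intervalIntegral.integral_const_mul, ← intervalIntegral.integral_const_mul]
  refine intervalIntegral.integral_mono_on_of_le_Ioo (by linarith)
    (((intervalIntegral.intervalIntegrable_rpow' (by linarith)).const_mul _).const_mul _)
    ((intervalIntegrable_kernel_cell (by linarith) hα1 hin).const_mul _) fun x hx => ?_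
  have h0 : (0 : ℝ) < x := lt_of_le_of_lt hi hx.1
  have h1 : ((n : ℝ) - i) ^ (-α) ≤ ((n : ℝ) - x) ^ (-α) :=
    Real.rpow_le_rpow_of_nonpos (by linarith [hx.2]) (by linarith [hx.1]) (by linarith)
  have h2 : 0 ≤ α * x ^ (α - 1) := by positivity
  nlinarith [mul_le_mul_of_nonneg_left h1 h2]

lemma cellMean_le (hα : 0 < α) (hα1 : α < 1) {i n : ℕ} (hin : i + 1 < n) :
    cellMean α i n ≤ ((n : ℝ) - (i + 1)) ^ (-α) := by
  have h : (i : ℝ) + 1 < n := by exact_mod_cast hin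
  have hi : (0 : ℝ) ≤ i := by positivity
  rw [cellMean, div_le_iff₀ (powStep_pos hα i), quadWeight_eq (by omega),
    ← integral_rpow_cell hα i,
    ← intervalIntegral.integral_const_mul, ← intervalIntegral.integral_const_mul]
  refine intervalIntegral.integral_mono_on_of_le_Ioo (by linarith)
    ((intervalIntegrable_kernel_cell (by linarith) hα1 (by omega)).const_mul _)
    (((intervalIntegral.intervalIntegrable_rpow' (by linarith)).const_mul _).const_mul _)
    fun x hx => ?_
  have h0 : (0 : ℝ) < x := lt_of_le_of_lt hi hx.1
  have h1 : ((n : ℝ) - x) ^ (-α) ≤ ((n : ℝ) - (i + 1)) ^ (-α) :=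
    Real.rpow_le_rpow_of_nonpos (by linarith [hx.2]) (by linarith [hx.2]) (by linarith)
  have h2 : 0 ≤ α * x ^ (α - 1) := by positivity
  nlinarith [mul_le_mul_of_nonneg_left h1 h2]

/-- On the last cell the mean stays bounded: `x ≥ n (x - n + 1)` there, which compares the
weight `x ^ (α - 1)` with its translate to the first cell. -/
lemma cellMean_last_le (hα : 0 < α) (hα1 : α < 1) (i : ℕ) :
    cellMean α i (i + 1) ≤ quadWeight α 1 1 := by
  have h11 : quadWeight α 1 1 = ∫ x in (0 : ℝ)..1, x ^ (α - 1) * (1 - x) ^ (-α) := by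
    simpa using quadWeight_eq (α := α) (i := 0) (n := 1) one_pos
  have hint : IntervalIntegrable (fun x : ℝ => x ^ (α - 1) * (1 - x) ^ (-α))
      MeasureTheory.volume 0 1 :=
    intervalIntegrable_rpow_mul_sub_rpow (by linarith) (by linarith) one_pos
  have hq : quadWeight α (i + 1) (i + 1) ≤ ((i : ℝ) + 1) ^ (α - 1) * quadWeight α 1 1 := by
    have hshift := (intervalIntegrable_kernel_cell (s := α - 1) (by linarith) hα1
      (Nat.lt_succ_self i)).comp_add_right (i : ℝ)
    have heq := intervalIntegral.integral_comp_add_right (a := 0) (b := 1)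
      (fun x : ℝ => x ^ (α - 1) * (((i + 1 : ℕ) : ℝ) - x) ^ (-α)) (i : ℝ)
    rw [zero_add, add_comm (1 : ℝ)] at heq
    rw [quadWeight_eq (Nat.lt_succ_self i), h11, ← heq, ← intervalIntegral.integral_const_mul]
    rw [sub_self, add_sub_cancel_left] at hshift
    refine intervalIntegral.integral_mono_on_of_le_Ioo zero_le_one hshift
      (hint.const_mul _) fun x hx => ?_
    have e : ((i + 1 : ℕ) : ℝ) - (x + i) = 1 - x := by push_cast; ring
    have h1 : (x + i) ^ (α - 1) ≤ (((i : ℝ) + 1) * x) ^ (α - 1) :=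
      Real.rpow_le_rpow_of_nonpos (mul_pos (by positivity) hx.1) (by nlinarith [hx.2])
        (by linarith)
    rw [Real.mul_rpow (by positivity) hx.1.le] at h1
    have h2 : 0 ≤ (1 - x) ^ (-α) := Real.rpow_nonneg (by linarith [hx.2]) _
    rw [e, ← mul_assoc]
    exact mul_le_mul_of_nonneg_right h1 h2
  have hp := le_powStep hα hα1.le i
  have h0 : 0 ≤ quadWeight α 1 1 := by
    rw [h11]
    refine intervalIntegral.integral_nonneg zero_le_one fun x hx => ?_
    exact mul_nonneg (Real.rpow_nonneg hx.1 _) (Real.rpow_nonneg (by linarith [hx.2]) _)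
  rw [cellMean, div_le_iff₀ (powStep_pos hα i)]
  nlinarith [mul_le_mul_of_nonneg_left hp h0, mul_le_mul_of_nonneg_left hq hα.le]

lemma sub_one_rpow_neg_le (hα1 : α ≤ 1) {y : ℝ} (hy : 2 ≤ y) :
    (y - 1) ^ (-α) ≤ y ^ (-α) + 2 * y ^ (-α - 1) := by
  have hy0 : 0 < y := by linarith
  have h1 : ((y - 1) / y) ^ (-α) ≤ y / (y - 1) := by
    rw [← inv_div (y - 1) y, ← Real.rpow_neg_one]
    exact Real.rpow_le_rpow_of_exponent_ge (div_pos (by linarith) hy0)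
      (by rw [div_le_one hy0]; linarith) (by linarith)
  have h2 : y / (y - 1) ≤ 1 + 2 / y := by
    rw [div_le_iff₀ (by linarith)]
    have h3 : 2 / y ≤ 1 := by rwa [div_le_one hy0]
    have h4 : 2 / y * y = 2 := by field_simp
    nlinarith
  have h5 : (y - 1) ^ (-α) = y ^ (-α) * ((y - 1) / y) ^ (-α) := by
    rw [← Real.mul_rpow hy0.le (div_nonneg (by linarith) hy0.le), mul_div_cancel₀ _ hy0.ne']
  rw [h5, Real.rpow_sub_one hy0.ne']
  calc y ^ (-α) * ((y - 1) / y) ^ (-α) ≤ y ^ (-α) * (1 + 2 / y) := by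
        gcongr
        exact h1.trans h2
    _ = y ^ (-α) + 2 * (y ^ (-α) / y) := by ring

lemma cellMean_mono (hα : 0 < α) (hα1 : α < 1) {i n : ℕ} (hin : i + 1 < n) :
    cellMean α i n ≤ cellMean α (i + 1) n := by
  refine (cellMean_le hα hα1 hin).trans ?_
  exact_mod_cast le_cellMean hα hα1 hin

/-- The cell mean exceeds the value of `(n - x) ^ (-α)` at the left end point by at most a
multiple of its derivative there. -/
lemma exists_cellMean_le (hα : 0 < α) (hα1 : α < 1) :
    ∃ C : ℝ, 0 < C ∧ ∀ i n : ℕ, i < n →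
      cellMean α i n ≤ ((n : ℝ) - i) ^ (-α) + C * ((n : ℝ) - i) ^ (-α - 1) := by
  refine ⟨|quadWeight α 1 1| + 2, by positivity, fun i n hin => ?_⟩
  have h : (i : ℝ) + 1 ≤ n := by exact_mod_cast hin
  rcases Nat.lt_or_ge (i + 1) n with h2 | h2
  · have h2' : (i : ℝ) + 1 + 1 ≤ n := by exact_mod_cast h2
    refine (cellMean_le hα hα1 h2).trans ?_
    set y : ℝ := (n : ℝ) - i with hy
    have hy2 : 2 ≤ y := by linarith
    rw [show (n : ℝ) - (i + 1) = y - 1 by rw [hy]; ring]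
    have h3 := sub_one_rpow_neg_le hα1.le hy2
    have h15 : 0 ≤ |quadWeight α 1 1| * y ^ (-α - 1) := by positivity
    linarith
  · obtain rfl : n = i + 1 := by omega
    have e : ((i + 1 : ℕ) : ℝ) - i = 1 := by push_cast; ring
    rw [e, Real.one_rpow, Real.one_rpow]
    linarith [cellMean_last_le hα hα1 i, le_abs_self (quadWeight α 1 1)]

end

/-! ### The discrete derivative and its maximum principle -/

/-- The discrete Caputo derivative on the grid of step one, without the factor `1 / Γ(1 - α)`:
the Caputo integral of the interpolant that is linear in `x ^ α` on each cell. -/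
noncomputable def discreteCaputo {E : Type*} [AddCommGroup E] [Module ℝ E] (α : ℝ) (g : ℕ → E)
    (n : ℕ) : E :=
  ∑ i ∈ Finset.range n, cellMean α i n • (g (i + 1) - g i)

section
variable {α : ℝ}

lemma sum_smul_sub_eq {E : Type*} [AddCommGroup E] [Module ℝ E] (B : ℕ → ℝ) (g : ℕ → E) (m : ℕ) :
    ∑ i ∈ Finset.range (m + 1), B i • (g (i + 1) - g i) =
      B m • g (m + 1) - B 0 • g 0 - ∑ i ∈ Finset.range m, (B (i + 1) - B i) • g (i + 1) := by
  induction m with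
  | zero => simp [smul_sub]
  | succ m ih =>
    rw [Finset.sum_range_succ, ih, Finset.sum_range_succ (n := m)]
    module

lemma schemeCoeff_zero (hα : 0 < α) (n : ℕ) :
    schemeCoeff α 0 n = (Real.Gamma (1 - α))⁻¹ * -cellMean α 0 n := by
  rw [schemeCoeff, if_pos rfl, cellMean, powStep]
  simp only [Nat.cast_zero, zero_add, Real.one_rpow, Real.zero_rpow hα.ne', sub_zero, div_one]
  ring

lemma schemeCoeff_succ {i n : ℕ} (hin : i + 1 < n) :
    schemeCoeff α (i + 1) n =
      (Real.Gamma (1 - α))⁻¹ * -(cellMean α (i + 1) n - cellMean α i n) := by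
  rw [schemeCoeff, if_neg (Nat.succ_ne_zero i), if_pos hin, cellMean, cellMean, powStep, powStep]
  push_cast
  rw [add_sub_cancel_right]
  ring

lemma schemeCoeff_last (m : ℕ) :
    schemeCoeff α (m + 1) (m + 1) = (Real.Gamma (1 - α))⁻¹ * cellMean α m (m + 1) := by
  rw [schemeCoeff, if_neg (Nat.succ_ne_zero m), if_neg (lt_irrefl _), cellMean, powStep]
  push_cast
  rw [add_sub_cancel_right]
  ring

lemma sum_schemeCoeff_mul (hα : 0 < α) (g : ℕ → ℂ) {n : ℕ} (hn : 1 ≤ n) :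
    ∑ j ∈ Finset.range (n + 1), ((schemeCoeff α j n : ℝ) : ℂ) * g j =
      (Real.Gamma (1 - α))⁻¹ • discreteCaputo α g n := by
  obtain ⟨m, rfl⟩ : ∃ m, n = m + 1 := ⟨n - 1, by omega⟩
  rw [discreteCaputo, sum_smul_sub_eq, Finset.sum_range_succ, Finset.sum_range_succ',
    schemeCoeff_zero hα, schemeCoeff_last]
  have h : ∑ i ∈ Finset.range m, ((schemeCoeff α (i + 1) (m + 1) : ℝ) : ℂ) * g (i + 1) =
      (Real.Gamma (1 - α))⁻¹ • -∑ i ∈ Finset.range m,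
        (cellMean α (i + 1) (m + 1) - cellMean α i (m + 1)) • g (i + 1) := by
    rw [← Finset.sum_neg_distrib, Finset.smul_sum]
    refine Finset.sum_congr rfl fun i hi => ?_
    rw [schemeCoeff_succ (by simpa using hi)]
    simp only [Complex.real_smul]
    push_cast
    ring
  rw [h]
  simp only [Complex.real_smul]
  push_cast
  ring

lemma discreteCaputo_sub {E : Type*} [AddCommGroup E] [Module ℝ E] (f g : ℕ → E) (n : ℕ) :
    discreteCaputo α (fun j => f j - g j) n = discreteCaputo α f n - discreteCaputo α g n := by
  simp only [discreteCaputo, ← Finset.sum_sub_distrib]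
  exact Finset.sum_congr rfl fun i _ => by module

lemma cellMean_nonneg (hα : 0 < α) (hα1 : α < 1) {i n : ℕ} (hin : i < n) :
    0 ≤ cellMean α i n := by
  refine le_trans (Real.rpow_nonneg ?_ _) (le_cellMean hα hα1 hin)
  rw [sub_nonneg]
  exact_mod_cast hin.le

/-- Discrete minimum principle: lowering the earlier values of a sequence raises its
discrete derivative. -/
lemma discreteCaputo_anti (hα : 0 < α) (hα1 : α < 1) {w u : ℕ → ℝ} {n : ℕ} (hn : 1 ≤ n)
    (hle : ∀ j < n, w j ≤ u j) (heq : w n = u n) :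
    discreteCaputo α u n ≤ discreteCaputo α w n := by
  obtain ⟨m, rfl⟩ : ∃ m, n = m + 1 := ⟨n - 1, by omega⟩
  have h0 : cellMean α 0 (m + 1) * w 0 ≤ cellMean α 0 (m + 1) * u 0 :=
    mul_le_mul_of_nonneg_left (hle 0 (by omega)) (cellMean_nonneg hα hα1 (by omega))
  have hs : ∑ i ∈ Finset.range m, (cellMean α (i + 1) (m + 1) - cellMean α i (m + 1)) * w (i + 1) ≤
      ∑ i ∈ Finset.range m, (cellMean α (i + 1) (m + 1) - cellMean α i (m + 1)) * u (i + 1) := by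
    refine Finset.sum_le_sum fun i hi => ?_
    have hi' := Finset.mem_range.1 hi
    exact mul_le_mul_of_nonneg_left (hle _ (by omega))
      (sub_nonneg.2 (cellMean_mono hα hα1 (by omega)))
  rw [discreteCaputo, discreteCaputo, sum_smul_sub_eq, sum_smul_sub_eq]
  simp only [smul_eq_mul, heq]
  linarith

/-- Comparison principle: the real part of `c` being nonpositive, a sequence is dominated by
every real barrier whose residual for the real equation with coefficient `Re c` dominates its
own residual. -/
lemma norm_le_of_barrier (hα : 0 < α) (hα1 : α < 1) {N : ℕ} {g : ℕ → ℂ} {w : ℕ → ℝ} {c : ℂ}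
    (hc : c.re ≤ 0) (h0 : ‖g 0‖ ≤ w 0)
    (h : ∀ n, 1 ≤ n → n ≤ N →
      ‖discreteCaputo α g n - c * g n‖ ≤ discreteCaputo α w n + -c.re * w n) :
    ∀ n ≤ N, ‖g n‖ ≤ w n := by
  intro n
  induction n using Nat.strong_induction_on with
  | _ n ih =>
    intro hnN
    rcases Nat.eq_zero_or_pos n with rfl | hn
    · exact h0
    have hres := h n hn hnN
    obtain ⟨m, rfl⟩ : ∃ m, n = m + 1 := ⟨n - 1, by omega⟩
    rw [discreteCaputo, discreteCaputo, sum_smul_sub_eq, sum_smul_sub_eq] at hres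
    simp only [smul_eq_mul, Complex.real_smul] at hres
    set B := fun i => cellMean α i (m + 1) with hB
    have hB0 : 0 ≤ B 0 := cellMean_nonneg hα hα1 (by omega)
    have hBm : 0 < B m :=
      lt_of_lt_of_le (Real.rpow_pos_of_pos (by push_cast; linarith) _)
        (le_cellMean hα hα1 (Nat.lt_succ_self m))
    set S : ℂ := ∑ i ∈ Finset.range m, ((B (i + 1) - B i : ℝ) : ℂ) * g (i + 1) with hS
    set Sw : ℝ := ∑ i ∈ Finset.range m, (B (i + 1) - B i) * w (i + 1) with hSw
    have hSle : ‖S‖ ≤ Sw := by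
      refine (norm_sum_le _ _).trans (Finset.sum_le_sum fun i hi => ?_)
      have hi' := Finset.mem_range.1 hi
      have hmono : 0 ≤ B (i + 1) - B i := sub_nonneg.2 (cellMean_mono hα hα1 (by omega))
      rw [norm_mul, Complex.norm_of_nonneg hmono]
      exact mul_le_mul_of_nonneg_left (ih _ (by omega) (by omega)) hmono
    have h0' : ‖(B 0 : ℂ) * g 0‖ ≤ B 0 * w 0 := by
      rw [norm_mul, Complex.norm_of_nonneg hB0]
      exact mul_le_mul_of_nonneg_left h0 hB0
    have hdiag : (B m + -c.re) * ‖g (m + 1)‖ ≤ ‖((B m : ℂ) - c) * g (m + 1)‖ := by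
      rw [norm_mul]
      refine mul_le_mul_of_nonneg_right ?_ (norm_nonneg _)
      refine le_trans (le_of_eq ?_) (Complex.re_le_norm _)
      simp [sub_eq_add_neg]
    have htri : ‖((B m : ℂ) - c) * g (m + 1)‖ ≤ (B m + -c.re) * w (m + 1) := by
      have e : ((B m : ℂ) - c) * g (m + 1) =
          ((B m : ℂ) * g (m + 1) - (B 0 : ℂ) * g 0 - S - c * g (m + 1)) + (B 0 : ℂ) * g 0 + S := by
        ring
      rw [e]
      refine (norm_add₃_le).trans ?_
      have hres' : ‖(B m : ℂ) * g (m + 1) - (B 0 : ℂ) * g 0 - S - c * g (m + 1)‖ ≤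
        B m * w (m + 1) - B 0 * w 0 - Sw + -c.re * w (m + 1) := hres
      linarith
    exact le_of_mul_le_mul_left (hdiag.trans htri) (by linarith)

/-! ### The barrier -/

lemma sum_rpow_neg_le {q : ℝ} (hq : 0 ≤ q) (hq1 : q < 1) (m : ℕ) :
    ∑ i ∈ Finset.range m, ((i : ℝ) + 1) ^ (-q) ≤ (m : ℝ) ^ (1 - q) / (1 - q) := by
  have h : ∑ i ∈ Finset.range m, powStep (1 - q) i = (m : ℝ) ^ (1 - q) := by
    have := Finset.sum_range_sub (fun i : ℕ => (i : ℝ) ^ (1 - q)) m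
    simpa [powStep, Real.zero_rpow (by linarith : (1 : ℝ) - q ≠ 0)] using this
  rw [le_div_iff₀ (by linarith), ← h, Finset.sum_mul]
  refine Finset.sum_le_sum fun i _ => ?_
  have := le_powStep (α := 1 - q) (by linarith) (by linarith) i
  rwa [show 1 - q - 1 = -q by ring, mul_comm] at this

lemma rpow_neg_le_of_half_le {r S z : ℝ} (hr : 0 ≤ r) (hS : 0 < S) (hz : S / 2 ≤ z) :
    z ^ (-r) ≤ 2 ^ r * S ^ (-r) := by
  calc z ^ (-r) ≤ (S / 2) ^ (-r) :=
        Real.rpow_le_rpow_of_nonpos (by positivity) hz (by linarith)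
    _ = 2 ^ r * S ^ (-r) := by
        rw [Real.div_rpow hS.le (by norm_num), Real.rpow_neg (by norm_num : (0 : ℝ) ≤ 2)]
        field_simp

lemma rpow_neg_mul_rpow_neg_le {p q x y : ℝ} (hp : 0 ≤ p) (hp1 : p ≤ 1) (hq : 0 ≤ q) (hq1 : q ≤ 1)
    (hx : 0 < x) (hy : 0 < y) :
    x ^ (-q) * y ^ (-p) ≤
      2 * ((x + y) ^ (-p) * x ^ (-q)) + 2 * ((x + y) ^ (-q) * y ^ (-p)) := by
  have key : ∀ r : ℝ, 0 ≤ r → r ≤ 1 → ∀ z : ℝ, (x + y) / 2 ≤ z →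
      z ^ (-r) ≤ 2 * (x + y) ^ (-r) := by
    intro r hr hr1 z hz
    refine (rpow_neg_le_of_half_le hr (add_pos hx hy) hz).trans ?_
    gcongr
    calc (2 : ℝ) ^ r ≤ 2 ^ (1 : ℝ) := Real.rpow_le_rpow_of_exponent_le (by norm_num) hr1
      _ = 2 := by norm_num
  have p1 : 0 < x ^ (-q) := by positivity
  have p2 : 0 < y ^ (-p) := by positivity
  have p3 : 0 < (x + y) ^ (-q) := by positivity
  have p4 : 0 < (x + y) ^ (-p) := by positivity
  rcases le_total x y with h | h
  · have := key p hp hp1 y (by linarith)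
    nlinarith [mul_le_mul_of_nonneg_left this p1.le, mul_pos p3 p2]
  · have := key q hq hq1 x (by linarith)
    nlinarith [mul_le_mul_of_nonneg_right this p2.le, mul_pos p4 p1]

/-- Discrete form of the bound `x ^ (-q) * x ^ (-p) = O(x ^ (1 - p - q))` for convolutions. -/
lemma sum_rpow_neg_mul_rpow_neg_le {p q : ℝ} (hp : 0 ≤ p) (hp1 : p < 1) (hq : 0 ≤ q) (hq1 : q < 1)
    (m : ℕ) :
    ∑ i ∈ Finset.range m, ((i : ℝ) + 1) ^ (-q) * ((m : ℝ) - i) ^ (-p) ≤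
      (2 / (1 - q) + 2 / (1 - p)) * ((m : ℝ) + 1) ^ (1 - p - q) := by
  have hm : (0 : ℝ) < m + 1 := by positivity
  have hrefl : ∑ i ∈ Finset.range m, ((m : ℝ) - i) ^ (-p) =
      ∑ i ∈ Finset.range m, ((i : ℝ) + 1) ^ (-p) := by
    rw [← Finset.sum_range_reflect (fun i : ℕ => ((i : ℝ) + 1) ^ (-p)) m]
    refine Finset.sum_congr rfl fun i hi => ?_
    have hi' : i + 1 ≤ m := Finset.mem_range.1 hi
    rw [show m - 1 - i = m - (i + 1) by omega, Nat.cast_sub hi']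
    push_cast
    ring_nf
  have hbd : ∀ r : ℝ, 0 ≤ r → r < 1 →
      ∑ i ∈ Finset.range m, ((i : ℝ) + 1) ^ (-r) ≤ ((m : ℝ) + 1) ^ (1 - r) / (1 - r) := by
    intro r hr hr1
    refine (sum_rpow_neg_le hr hr1 m).trans ?_
    have : 0 < 1 - r := by linarith
    gcongr
    linarith
  calc ∑ i ∈ Finset.range m, ((i : ℝ) + 1) ^ (-q) * ((m : ℝ) - i) ^ (-p)
      ≤ ∑ i ∈ Finset.range m, (2 * ((m + 1 : ℝ) ^ (-p) * ((i : ℝ) + 1) ^ (-q)) +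
          2 * ((m + 1 : ℝ) ^ (-q) * ((m : ℝ) - i) ^ (-p))) := by
        refine Finset.sum_le_sum fun i hi => ?_
        have hi' : (i : ℝ) + 1 ≤ m := by exact_mod_cast Finset.mem_range.1 hi
        have := rpow_neg_mul_rpow_neg_le (x := (i : ℝ) + 1) (y := (m : ℝ) - i) hp hp1.le hq hq1.le
          (by positivity) (by linarith)
        rwa [show (i : ℝ) + 1 + (m - i) = m + 1 by ring] at this
    _ = 2 * ((m + 1 : ℝ) ^ (-p) * ∑ i ∈ Finset.range m, ((i : ℝ) + 1) ^ (-q)) +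
          2 * ((m + 1 : ℝ) ^ (-q) * ∑ i ∈ Finset.range m, ((i : ℝ) + 1) ^ (-p)) := by
        rw [Finset.sum_add_distrib, ← Finset.mul_sum, ← Finset.mul_sum, ← Finset.mul_sum,
          ← Finset.mul_sum, hrefl]
    _ ≤ 2 * ((m + 1 : ℝ) ^ (-p) * (((m : ℝ) + 1) ^ (1 - q) / (1 - q))) +
          2 * ((m + 1 : ℝ) ^ (-q) * (((m : ℝ) + 1) ^ (1 - p) / (1 - p))) := by
        gcongr
        · exact hbd q hq hq1
        · exact hbd p hp hp1
    _ = (2 / (1 - q) + 2 / (1 - p)) * ((m : ℝ) + 1) ^ (1 - p - q) := by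
        have e1 : ((m : ℝ) + 1) ^ (1 - p - q) = (m + 1 : ℝ) ^ (-p) * ((m : ℝ) + 1) ^ (1 - q) := by
          rw [← Real.rpow_add hm]; ring_nf
        have e2 : ((m : ℝ) + 1) ^ (1 - p - q) = (m + 1 : ℝ) ^ (-q) * ((m : ℝ) + 1) ^ (1 - p) := by
          rw [← Real.rpow_add hm]; ring_nf
        rw [add_mul]
        nth_rewrite 1 [e1]
        rw [e2]
        ring

/-- The sequence `j ^ p` with the value `0` at `j = 0`, whatever the exponent. -/
noncomputable def powSeq (p : ℝ) (j : ℕ) : ℝ := if j = 0 then 0 else (j : ℝ) ^ p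

@[simp] lemma powSeq_zero (p : ℝ) : powSeq p 0 = 0 := if_pos rfl

lemma powSeq_of_pos (p : ℝ) {j : ℕ} (hj : 1 ≤ j) : powSeq p j = (j : ℝ) ^ p :=
  if_neg (by omega)

lemma powSeq_succ (p : ℝ) (j : ℕ) : powSeq p (j + 1) = ((j : ℝ) + 1) ^ p := by
  rw [powSeq_of_pos p (by omega)]
  push_cast
  rfl

lemma le_discreteCaputo_powSeq (hα : 0 < α) (hα1 : α < 1) {p : ℝ} (hp : 0 ≤ p) {n : ℕ}
    (hn : 1 ≤ n) : (n : ℝ) ^ (p - α) ≤ discreteCaputo α (powSeq p) n := by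
  have hn0 : (0 : ℝ) < n := by exact_mod_cast hn
  have hmono : ∀ i, 0 ≤ powSeq p (i + 1) - powSeq p i := by
    intro i
    rw [sub_nonneg, powSeq_succ]
    rcases Nat.eq_zero_or_pos i with rfl | hi
    · simp
    · rw [powSeq_of_pos p hi]
      gcongr
      linarith
  have hB : ∀ i, i < n → (n : ℝ) ^ (-α) ≤ cellMean α i n := by
    intro i hi
    refine le_trans ?_ (le_cellMean hα hα1 hi)
    have hi' : (i : ℝ) < n := by exact_mod_cast hi
    exact Real.rpow_le_rpow_of_nonpos (by linarith) (by linarith [Nat.cast_nonneg (α := ℝ) i])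
      (by linarith)
  calc (n : ℝ) ^ (p - α) = (n : ℝ) ^ (-α) * (powSeq p n - powSeq p 0) := by
        rw [powSeq_of_pos p hn, powSeq_zero, sub_zero, ← Real.rpow_add hn0]
        ring_nf
    _ = ∑ i ∈ Finset.range n, (n : ℝ) ^ (-α) * (powSeq p (i + 1) - powSeq p i) := by
        rw [← Finset.mul_sum, Finset.sum_range_sub]
    _ ≤ discreteCaputo α (powSeq p) n :=
        Finset.sum_le_sum fun i hi =>
          mul_le_mul_of_nonneg_right (hB i (Finset.mem_range.1 hi)) (hmono i)

lemma exists_cellMean_succ_sub_le (hα : 0 < α) (hα1 : α < 1) :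
    ∃ C : ℝ, 0 < C ∧ ∀ i m : ℕ, i < m →
      cellMean α (i + 1) (m + 1) - cellMean α i (m + 1) ≤ C * ((m : ℝ) - i) ^ (-α - 1) := by
  obtain ⟨C, hC, hCle⟩ := exists_cellMean_le hα hα1
  refine ⟨C + 2, by positivity, fun i m him => ?_⟩
  have him' : (i : ℝ) + 1 ≤ m := by exact_mod_cast him
  have h1 := hCle (i + 1) (m + 1) (by omega)
  have h2 := le_cellMean hα hα1 (show i < m + 1 by omega)
  push_cast at h1 h2
  rw [show (m : ℝ) + 1 - (i + 1) = m - i by ring] at h1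
  have h3 := sub_one_rpow_neg_le hα1.le (y := (m : ℝ) + 1 - i) (by linarith)
  rw [show (m : ℝ) + 1 - i - 1 = m - i by ring] at h3
  have h4 : ((m : ℝ) + 1 - i) ^ (-α - 1) ≤ ((m : ℝ) - i) ^ (-α - 1) :=
    Real.rpow_le_rpow_of_nonpos (by linarith) (by linarith) (by linarith)
  linarith

/-- For a decaying power the discrete derivative may be negative, but it is of the order that
scaling predicts. -/
lemma exists_le_discreteCaputo_powSeq_neg (hα : 0 < α) (hα1 : α < 1) {q : ℝ} (hq : 0 ≤ q)
    (hq1 : q < 1) :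
    ∃ C : ℝ, 0 < C ∧ ∀ n : ℕ, 1 ≤ n →
      -(C * (n : ℝ) ^ (-α - q)) ≤ discreteCaputo α (powSeq (-q)) n := by
  obtain ⟨C, hC, hCle⟩ := exists_cellMean_succ_sub_le hα hα1
  have hq' : 0 < 1 - q := by linarith
  have hα' : 0 < 1 - α := by linarith
  refine ⟨C * (2 / (1 - q) + 2 / (1 - α)), by positivity, fun n hn => ?_⟩
  obtain ⟨m, rfl⟩ : ∃ m, n = m + 1 := ⟨n - 1, by omega⟩
  have hm : (0 : ℝ) < m + 1 := by positivity
  set B := fun i => cellMean α i (m + 1) with hB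
  have hB0 : 0 ≤ B 0 := cellMean_nonneg hα hα1 (by omega)
  have e : discreteCaputo α (powSeq (-q)) (m + 1) = B 0 * ((m : ℝ) + 1) ^ (-q) -
      ∑ i ∈ Finset.range m,
        (B (i + 1) - B i) * (((i : ℝ) + 1) ^ (-q) - ((m : ℝ) + 1) ^ (-q)) := by
    have h1 : ∑ i ∈ Finset.range m, (B (i + 1) - B i) = B m - B 0 := Finset.sum_range_sub B m
    have h2 : ∑ i ∈ Finset.range m,
        (B (i + 1) - B i) * (((i : ℝ) + 1) ^ (-q) - ((m : ℝ) + 1) ^ (-q)) =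
        ∑ i ∈ Finset.range m, (B (i + 1) - B i) * ((i : ℝ) + 1) ^ (-q) -
          (B m - B 0) * ((m : ℝ) + 1) ^ (-q) := by
      rw [← h1, Finset.sum_mul, ← Finset.sum_sub_distrib]
      exact Finset.sum_congr rfl fun i _ => by ring
    rw [h2, discreteCaputo, sum_smul_sub_eq]
    simp only [smul_eq_mul, powSeq_zero, powSeq_succ, hB]
    ring
  have hterm : ∀ i ∈ Finset.range m,
      (B (i + 1) - B i) * (((i : ℝ) + 1) ^ (-q) - ((m : ℝ) + 1) ^ (-q)) ≤
        C / (m + 1) * (((i : ℝ) + 1) ^ (-q) * ((m : ℝ) - i) ^ (-α)) := by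
    intro i hi
    have hi' := Finset.mem_range.1 hi
    have him : (i : ℝ) + 1 ≤ m := by exact_mod_cast hi'
    have hi0 : (0 : ℝ) < i + 1 := by positivity
    have hmi : 0 < (m : ℝ) - i := by linarith
    have h1 : ((i : ℝ) + 1) ^ (-q) - ((m : ℝ) + 1) ^ (-q) ≤
        ((i : ℝ) + 1) ^ (-q) * (((m : ℝ) - i) / (m + 1)) := by
      -- `θ ^ q ≥ θ` for `θ = (i + 1) / (m + 1) ≤ 1`
      have h2 : ((i : ℝ) + 1) / (m + 1) ≤ (((i : ℝ) + 1) / (m + 1)) ^ q := by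
        conv_lhs => rw [← Real.rpow_one (((i : ℝ) + 1) / (m + 1))]
        exact Real.rpow_le_rpow_of_exponent_ge (by positivity)
          (by rw [div_le_one hm]; linarith) hq1.le
      have h3 : ((m : ℝ) + 1) ^ (-q) =
          ((i : ℝ) + 1) ^ (-q) * (((i : ℝ) + 1) / (m + 1)) ^ q := by
        rw [Real.div_rpow hi0.le hm.le, Real.rpow_neg hi0.le, Real.rpow_neg hm.le]
        field_simp
      have h4 : ((m : ℝ) - i) / (m + 1) = 1 - ((i : ℝ) + 1) / (m + 1) := by
        field_simp
        ring
      have h5 : 0 < ((i : ℝ) + 1) ^ (-q) := by positivity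
      rw [h3, h4]
      nlinarith [mul_le_mul_of_nonneg_left h2 h5.le]
    have hmono : 0 ≤ B (i + 1) - B i := sub_nonneg.2 (cellMean_mono hα hα1 (by omega))
    have h6 : ((m : ℝ) - i) ^ (-α) = ((m : ℝ) - i) ^ (-α - 1) * ((m : ℝ) - i) := by
      rw [Real.rpow_sub_one hmi.ne']
      field_simp
    calc (B (i + 1) - B i) * (((i : ℝ) + 1) ^ (-q) - ((m : ℝ) + 1) ^ (-q))
        ≤ (B (i + 1) - B i) * (((i : ℝ) + 1) ^ (-q) * (((m : ℝ) - i) / (m + 1))) :=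
          mul_le_mul_of_nonneg_left h1 hmono
      _ ≤ C * ((m : ℝ) - i) ^ (-α - 1) *
            (((i : ℝ) + 1) ^ (-q) * (((m : ℝ) - i) / (m + 1))) :=
          mul_le_mul_of_nonneg_right (hCle i m hi') (by positivity)
      _ = C / (m + 1) * (((i : ℝ) + 1) ^ (-q) * ((m : ℝ) - i) ^ (-α)) := by
          rw [h6]
          ring
  have hsum := Finset.sum_le_sum hterm
  rw [← Finset.mul_sum] at hsum
  have hconv := mul_le_mul_of_nonneg_left
    (sum_rpow_neg_mul_rpow_neg_le hα.le hα1 hq hq1 m) (show 0 ≤ C / ((m : ℝ) + 1) by positivity)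
  have e2 : C / ((m : ℝ) + 1) * ((2 / (1 - q) + 2 / (1 - α)) * ((m : ℝ) + 1) ^ (1 - α - q)) =
      C * (2 / (1 - q) + 2 / (1 - α)) * (((m + 1 : ℕ) : ℝ)) ^ (-α - q) := by
    have e3 : ((m : ℝ) + 1) ^ (1 - α - q) = ((m : ℝ) + 1) ^ (-α - q) * (m + 1) := by
      rw [← Real.rpow_add_one hm.ne']
      ring_nf
    rw [e3]
    push_cast
    field_simp
  have h7 : 0 ≤ B 0 * ((m : ℝ) + 1) ^ (-q) := by positivity
  rw [e]
  linarith

/-- The barrier is `min (κ n ^ (α - q) / L) (n ^ (-q))` up to a constant. The first member is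
increasing, so that its discrete derivative is positive; the second one is the smaller where
`κ n ^ α ≥ L`, and there `κ n ^ (-q)` outweighs its derivative. -/
lemma exists_barrier (hα : 0 < α) (hα1 : α < 1) {q : ℝ} (hq : 0 ≤ q) (hqα : q ≤ α) :
    ∃ C : ℝ, 0 < C ∧ ∀ κ : ℝ, 0 ≤ κ → ∃ w : ℕ → ℝ, w 0 = 0 ∧ ∀ n : ℕ, 1 ≤ n →
      w n ≤ C * (n : ℝ) ^ (-q) ∧ κ * (n : ℝ) ^ (-q) ≤ discreteCaputo α w n + κ * w n := by
  obtain ⟨A, hA, hAle⟩ := exists_le_discreteCaputo_powSeq_neg hα hα1 hq (hqα.trans_lt hα1)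
  refine ⟨2 * A + 2, by positivity, fun κ hκ => ?_⟩
  have caputo_mul : ∀ (a : ℝ) (u : ℕ → ℝ) (n : ℕ),
      discreteCaputo α (fun j => a * u j) n = a * discreteCaputo α u n := by
    intro a u n
    simp only [discreteCaputo, smul_eq_mul, Finset.mul_sum]
    exact Finset.sum_congr rfl fun i _ => by ring
  set C := 2 * A + 2 with hC
  have hC0 : 0 < C := by positivity
  set u₁ : ℕ → ℝ := fun j => C * κ / (2 * A) * powSeq (α - q) j with hu₁
  set u₂ : ℕ → ℝ := fun j => C * powSeq (-q) j with hu₂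
  refine ⟨fun j => min (u₁ j) (u₂ j), by simp [hu₁, hu₂], fun n hn => ?_⟩
  have hn0 : (0 : ℝ) < n := by exact_mod_cast hn
  have hnq : 0 < (n : ℝ) ^ (-q) := by positivity
  have hu₂n : u₂ n = C * (n : ℝ) ^ (-q) := by rw [hu₂]; simp only [powSeq_of_pos _ hn]
  have hu₁n : u₁ n = C * κ / (2 * A) * (n : ℝ) ^ (α - q) := by
    rw [hu₁]; simp only [powSeq_of_pos _ hn]
  refine ⟨(min_le_right _ _).trans hu₂n.le, ?_⟩
  rcases le_total (u₁ n) (u₂ n) with h | h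
  · have h1 := discreteCaputo_anti hα hα1 (w := fun j => min (u₁ j) (u₂ j)) (u := u₁) hn
      (fun j _ => min_le_left _ _) (min_eq_left h)
    have h2 : discreteCaputo α u₁ n = C * κ / (2 * A) * discreteCaputo α (powSeq (α - q)) n :=
      caputo_mul _ _ _
    have h3 := mul_le_mul_of_nonneg_left
      (le_discreteCaputo_powSeq hα hα1 (p := α - q) (by linarith) hn)
      (show 0 ≤ C * κ / (2 * A) by positivity)
    rw [show α - q - α = -q by ring] at h3
    have h4 : κ ≤ C * κ / (2 * A) := by
      rw [le_div_iff₀ (by positivity)]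
      nlinarith
    have h5 : 0 ≤ κ * min (u₁ n) (u₂ n) := by
      refine mul_nonneg hκ (le_min ?_ ?_)
      · rw [hu₁n]; positivity
      · rw [hu₂n]; positivity
    nlinarith [mul_le_mul_of_nonneg_right h4 hnq.le]
  · have h1 := discreteCaputo_anti hα hα1 (w := fun j => min (u₁ j) (u₂ j)) (u := u₂) hn
      (fun j _ => min_le_right _ _) (min_eq_right h)
    have h2 : discreteCaputo α u₂ n = C * discreteCaputo α (powSeq (-q)) n := caputo_mul _ _ _
    have h3 := mul_le_mul_of_nonneg_left (hAle n hn) hC0.le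
    have h4 : min (u₁ n) (u₂ n) = C * (n : ℝ) ^ (-q) := by rw [min_eq_right h, hu₂n]
    have h5 : 2 * A * (n : ℝ) ^ (-α - q) ≤ κ * (n : ℝ) ^ (-q) := by
      rw [hu₁n, hu₂n] at h
      have e1 : (n : ℝ) ^ (-q) = (n : ℝ) ^ (-α - q) * (n : ℝ) ^ α := by
        rw [← Real.rpow_add hn0]; ring_nf
      have e2 : (n : ℝ) ^ (α - q) = (n : ℝ) ^ (-q) * (n : ℝ) ^ α := by
        rw [← Real.rpow_add hn0]; ring_nf
      rw [e2] at h
      have h6 : C * (n : ℝ) ^ (-q) * (2 * A) ≤ C * (n : ℝ) ^ (-q) * (κ * (n : ℝ) ^ α) := by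
        calc C * (n : ℝ) ^ (-q) * (2 * A)
            ≤ C * κ / (2 * A) * ((n : ℝ) ^ (-q) * (n : ℝ) ^ α) * (2 * A) := by gcongr
          _ = C * (n : ℝ) ^ (-q) * (κ * (n : ℝ) ^ α) := by field_simp
      have h7 : 2 * A ≤ κ * (n : ℝ) ^ α := le_of_mul_le_mul_left h6 (by positivity)
      rw [e1]
      nlinarith [mul_le_mul_of_nonneg_right h7 (Real.rpow_nonneg hn0.le (-α - q))]
    simp only [h4]
    nlinarith [mul_le_mul_of_nonneg_left h5 hC0.le, mul_nonneg hκ hnq.le, mul_nonneg hA.le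
      (mul_nonneg hκ hnq.le)]

/-- Stability: residuals bounded by `K |Re c| n ^ (-q)` produce deviations of order
`K n ^ (-q)`, uniformly in `c` with nonpositive real part. -/
lemma exists_norm_le_of_residual (hα : 0 < α) (hα1 : α < 1) {q : ℝ} (hq : 0 ≤ q) (hqα : q ≤ α) :
    ∃ C : ℝ, 0 < C ∧ ∀ (N : ℕ) (g : ℕ → ℂ) (c : ℂ) (K : ℝ), c.re ≤ 0 → 0 ≤ K →
      (∀ n : ℕ, 1 ≤ n → n ≤ N →
        ‖discreteCaputo α g n - c * g n‖ ≤ K * -c.re * (n : ℝ) ^ (-q)) →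
      ∀ n : ℕ, 1 ≤ n → n ≤ N → ‖g n‖ ≤ ‖g 0‖ + C * K * (n : ℝ) ^ (-q) := by
  obtain ⟨C, hC, hbar⟩ := exists_barrier hα hα1 hq hqα
  refine ⟨C, hC, fun N g c K hc hK hres n hn hnN => ?_⟩
  obtain ⟨w, hw0, hw⟩ := hbar (-c.re) (by linarith)
  have h := norm_le_of_barrier hα hα1 (N := N) (g := g) (w := fun j => ‖g 0‖ + K * w j) hc
    (by simp [hw0]) (fun k hk hkN => ?_) n hnN
  · have := mul_le_mul_of_nonneg_left (hw n hn).1 hK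
    linarith
  · have e : discreteCaputo α (fun j => ‖g 0‖ + K * w j) k = K * discreteCaputo α w k := by
      simp only [discreteCaputo, smul_eq_mul, Finset.mul_sum]
      exact Finset.sum_congr rfl fun i _ => by ring
    rw [e]
    have h1 := mul_le_mul_of_nonneg_left (hw k hk).2 hK
    have h2 : 0 ≤ -c.re * ‖g 0‖ := mul_nonneg (by linarith) (norm_nonneg _)
    linarith [hres k hk hkN]

end

/-! ### The Mittag-Leffler function solves the continuous problem -/

section
variable {α : ℝ}

/-- `E_α(μ x ^ α)` has Caputo derivative `μ E_α(μ x ^ α)`; the factor `1 / Γ(1 - α)` is on the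
right-hand side here. Each term of the series is a Beta integral. -/
lemma integral_deriv_mittagLeffler (hα : 0 < α) (hα1 : α < 1) (μ : ℂ) {a : ℝ} (ha : 0 < a) :
    ∫ x in (0 : ℝ)..a, μ * deriv (mittagLeffler α) (μ * ((x ^ α : ℝ) : ℂ)) *
        ((α * x ^ (α - 1) * (a - x) ^ (-α) : ℝ) : ℂ) =
      (Real.Gamma (1 - α) : ℂ) * μ * mittagLeffler α (μ * ((a ^ α : ℝ) : ℂ)) := by
  set F : ℕ → ℝ → ℂ := fun j x => μ ^ (j + 1) / ((Real.Gamma (α * ((j : ℝ) + 1)) : ℝ) : ℂ) *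
    ((x ^ (α * ((j : ℝ) + 1) - 1) * (a - x) ^ (-α) : ℝ) : ℂ) with hF
  have hΓ : ∀ j : ℕ, 0 < Real.Gamma (α * ((j : ℝ) + 1)) := fun j =>
    Real.Gamma_pos_of_pos (by positivity)
  have hΓ1 : ∀ j : ℕ, 0 < Real.Gamma (α * (j : ℝ) + 1) := fun j =>
    Real.Gamma_pos_of_pos (by positivity)
  have hexp : ∀ j : ℕ, (-1 : ℝ) < α * ((j : ℝ) + 1) - 1 := fun j => by
    have : 0 < α * ((j : ℝ) + 1) := by positivity
    linarith
  have hreal : ∀ j : ℕ, IntervalIntegrable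
      (fun x : ℝ => x ^ (α * ((j : ℝ) + 1) - 1) * (a - x) ^ (-α)) MeasureTheory.volume 0 a :=
    fun j => intervalIntegrable_rpow_mul_sub_rpow (hexp j) (by linarith) ha
  have hval : ∀ j : ℕ, ∫ x in (0 : ℝ)..a, x ^ (α * ((j : ℝ) + 1) - 1) * (a - x) ^ (-α) =
      (a ^ α) ^ j * (Real.Gamma (α * ((j : ℝ) + 1)) * Real.Gamma (1 - α) /
        Real.Gamma (α * (j : ℝ) + 1)) := by
    intro j
    have h := integral_rpow_mul_sub_rpow (s := α * ((j : ℝ) + 1)) (t := 1 - α) (a := a)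
      (by positivity) (by linarith) ha
    rw [show 1 - α - 1 = -α by ring, show α * ((j : ℝ) + 1) + (1 - α) = α * j + 1 by ring,
      show α * (j : ℝ) + 1 - 1 = α * j by ring, Real.rpow_mul ha.le, Real.rpow_natCast] at h
    exact h
  have hsum : ∀ x ∈ Set.Ioc (0 : ℝ) a, HasSum (fun j => F j x)
      (μ * deriv (mittagLeffler α) (μ * ((x ^ α : ℝ) : ℂ)) *
        ((α * x ^ (α - 1) * (a - x) ^ (-α) : ℝ) : ℂ)) := by
    intro x hx
    have h := (hasSum_nat_add_iff' 1).2 (hasSum_deriv_mittagLeffler hα (μ * ((x ^ α : ℝ) : ℂ)))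
    simp only [Finset.range_one, Finset.sum_singleton, Nat.cast_zero, zero_mul, zero_div,
      sub_zero] at h
    convert! (h.mul_left μ).mul_right
      ((α * x ^ (α - 1) * (a - x) ^ (-α) : ℝ) : ℂ) using 1
    funext j
    have hj : ((Real.Gamma (α * ((j : ℝ) + 1)) : ℝ) : ℂ) ≠ 0 :=
      Complex.ofReal_ne_zero.2 (hΓ j).ne'
    have hj1 : (j : ℂ) + 1 ≠ 0 := Nat.cast_add_one_ne_zero j
    have hα' : (α : ℂ) ≠ 0 := Complex.ofReal_ne_zero.2 hα.ne'
    have e1 : x ^ (α * ((j : ℝ) + 1) - 1) = (x ^ α) ^ j * x ^ (α - 1) := by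
      rw [← Real.rpow_natCast, ← Real.rpow_mul hx.1.le, ← Real.rpow_add hx.1]
      ring_nf
    rw [hF]
    simp only
    push_cast
    rw [Real.Gamma_add_one (by positivity), e1, mul_pow]
    push_cast
    field_simp
    ring
  have hint : ∀ j, MeasureTheory.Integrable (F j)
      (MeasureTheory.volume.restrict (Set.Ioc 0 a)) := fun j =>
    ((((intervalIntegrable_iff_integrableOn_Ioc_of_le ha.le).1 (hreal j)).ofReal).const_mul _)
  have hnorm : ∀ j, ∫ x in Set.Ioc 0 a, ‖F j x‖ =
      ‖μ‖ * Real.Gamma (1 - α) * ((‖μ‖ * a ^ α) ^ j / Real.Gamma (α * j + 1)) := by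
    intro j
    have h1 : ∀ x ∈ Set.Ioc (0 : ℝ) a, ‖F j x‖ =
        ‖μ‖ ^ (j + 1) / Real.Gamma (α * ((j : ℝ) + 1)) *
          (x ^ (α * ((j : ℝ) + 1) - 1) * (a - x) ^ (-α)) := by
      intro x hx
      have h2 : 0 ≤ x ^ (α * ((j : ℝ) + 1) - 1) * (a - x) ^ (-α) :=
        mul_nonneg (Real.rpow_nonneg hx.1.le _) (Real.rpow_nonneg (by linarith [hx.2]) _)
      rw [hF]
      simp only
      rw [norm_mul, norm_div, norm_pow, Complex.norm_of_nonneg (hΓ j).le,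
        Complex.norm_of_nonneg h2]
    rw [MeasureTheory.setIntegral_congr_fun measurableSet_Ioc h1,
      ← intervalIntegral.integral_of_le ha.le, intervalIntegral.integral_const_mul, hval]
    have := (hΓ j).ne'
    have := (hΓ1 j).ne'
    field_simp
    ring
  have hmain := MeasureTheory.hasSum_integral_of_summable_integral_norm hint
    (by
      simp only [hnorm]
      exact (summable_pow_div_Gamma hα (by positivity)).mul_left _)
  have hterm : ∀ j, ∫ x in Set.Ioc 0 a, F j x = (Real.Gamma (1 - α) : ℂ) * μ *
      ((μ * ((a ^ α : ℝ) : ℂ)) ^ j / ((Real.Gamma (α * (j : ℝ) + 1) : ℝ) : ℂ)) := by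
    intro j
    rw [← intervalIntegral.integral_of_le ha.le, hF]
    simp only
    rw [intervalIntegral.integral_const_mul, intervalIntegral.integral_ofReal, hval]
    have h1 : ((Real.Gamma (α * ((j : ℝ) + 1)) : ℝ) : ℂ) ≠ 0 :=
      Complex.ofReal_ne_zero.2 (hΓ j).ne'
    have h2 : ((Real.Gamma (α * (j : ℝ) + 1) : ℝ) : ℂ) ≠ 0 :=
      Complex.ofReal_ne_zero.2 (hΓ1 j).ne'
    rw [Complex.ofReal_mul, Complex.ofReal_div, Complex.ofReal_mul, Complex.ofReal_pow]
    field_simp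
    ring
  simp only [hterm] at hmain
  rw [intervalIntegral.integral_of_le ha.le,
    ← MeasureTheory.setIntegral_congr_fun measurableSet_Ioc fun x hx => (hsum x hx).tsum_eq]
  exact hmain.unique ((hasSum_mittagLeffler hα _).mul_left _)

/-! ### Truncation error -/

/-- The difference quotient over `[a, b]` differs from the derivative at any point of `[a, b]`
by at most `(b - a) sup |f''|`. -/
lemma norm_sub_sub_smul_le_of_norm_deriv_deriv_le {f f' f'' : ℝ → ℂ}
    (hf : ∀ t, HasDerivAt f (f' t) t) (hf' : ∀ t, HasDerivAt f' (f'' t) t) {a b y M : ℝ}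
    (hM : ∀ t ∈ Set.Icc a b, ‖f'' t‖ ≤ M) (hy : y ∈ Set.Icc a b) :
    ‖f b - f a - (b - a : ℝ) * f' y‖ ≤ M * (b - a) ^ 2 := by
  have hab : a ≤ b := hy.1.trans hy.2
  have hM0 : 0 ≤ M := (norm_nonneg _).trans (hM y hy)
  have h1 : ∀ t ∈ Set.Icc a b, ‖f' t - f' y‖ ≤ M * (b - a) := by
    intro t ht
    refine ((convex_Icc a b).norm_image_sub_le_of_norm_hasDerivWithin_le
      (fun s _ => (hf' s).hasDerivWithinAt) hM hy ht).trans ?_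
    refine mul_le_mul_of_nonneg_left ?_ hM0
    rw [Real.norm_eq_abs, abs_le]
    constructor <;> linarith [ht.1, ht.2, hy.1, hy.2]
  have h2 : ∀ t, HasDerivAt (fun t : ℝ => f t - (t : ℂ) * f' y) (f' t - f' y) t := by
    intro t
    have h3 : HasDerivAt (fun t : ℝ => (t : ℂ) * f' y) (1 * f' y) t :=
      (Complex.ofRealCLM.hasDerivAt (x := t)).mul_const _
    rw [one_mul] at h3
    exact (hf t).sub h3
  have h4 := (convex_Icc a b).norm_image_sub_le_of_norm_hasDerivWithin_le
    (fun s _ => (h2 s).hasDerivWithinAt) h1 (Set.left_mem_Icc.2 hab) (Set.right_mem_Icc.2 hab)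
  rw [Real.norm_of_nonneg (by linarith)] at h4
  calc ‖f b - f a - (b - a : ℝ) * f' y‖ = ‖f b - (b : ℂ) * f' y - (f a - (a : ℂ) * f' y)‖ := by
        congr 1
        push_cast
        ring
    _ ≤ M * (b - a) * (b - a) := h4
    _ = M * (b - a) ^ 2 := by ring

/-- Interpolation error of the Caputo integral on one cell. The error of the derivative has mean
zero on the cell with respect to `d(x ^ α)`, so the kernel may be replaced by its deviation from
its value at the left end point. -/
lemma norm_cell_error_le (hα : 0 < α) (hα1 : α < 1) {f f' f'' : ℝ → ℂ}
    (hf : ∀ t, HasDerivAt f (f' t) t) (hf' : ∀ t, HasDerivAt f' (f'' t) t) {i n : ℕ}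
    (hin : i < n) {M : ℝ}
    (hM : ∀ t ∈ Set.Icc ((i : ℝ) ^ α) (((i : ℝ) + 1) ^ α), ‖f'' t‖ ≤ M) :
    ‖cellMean α i n • (f (((i : ℝ) + 1) ^ α) - f ((i : ℝ) ^ α)) -
        ∫ x in (i : ℝ)..(i + 1), f' (x ^ α) * ((α * x ^ (α - 1) * ((n : ℝ) - x) ^ (-α) : ℝ) : ℂ)‖ ≤
      M * powStep α i ^ 2 * (cellMean α i n - ((n : ℝ) - i) ^ (-α)) := by
  have hi : (0 : ℝ) ≤ i := by positivity
  have hΔ := powStep_pos hα i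
  set Δ := powStep α i with hΔdef
  set d : ℂ := f (((i : ℝ) + 1) ^ α) - f ((i : ℝ) ^ α) with hd
  set c₀ : ℝ := ((n : ℝ) - i) ^ (-α) with hc₀
  have hw : IntervalIntegrable (fun x : ℝ => α * x ^ (α - 1)) MeasureTheory.volume
      (i : ℝ) (i + 1) :=
    (intervalIntegral.intervalIntegrable_rpow' (by linarith)).const_mul _
  have hk : IntervalIntegrable (fun x : ℝ => α * x ^ (α - 1) * ((n : ℝ) - x) ^ (-α))
      MeasureTheory.volume (i : ℝ) (i + 1) := by
    simpa only [mul_assoc] using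
      (intervalIntegrable_kernel_cell (s := α - 1) (by linarith) hα1 hin).const_mul α
  have hcpow : Continuous fun x : ℝ => x ^ α := Real.continuous_rpow_const hα.le
  have hcf : Continuous f := continuous_iff_continuousAt.2 fun t => (hf t).continuousAt
  have hcf' : Continuous f' := continuous_iff_continuousAt.2 fun t => (hf' t).continuousAt
  have hcF : Continuous fun x : ℝ => f' (x ^ α) := hcf'.comp hcpow
  have hcφ : Continuous fun x : ℝ => d / (Δ : ℂ) - f' (x ^ α) := by fun_prop
  have hΔ' : (Δ : ℂ) ≠ 0 := Complex.ofReal_ne_zero.2 hΔ.ne'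
  have ofReal_int : ∀ {u : ℝ → ℝ}, IntervalIntegrable u MeasureTheory.volume (i : ℝ) (i + 1) →
      IntervalIntegrable (fun x => ((u x : ℝ) : ℂ)) MeasureTheory.volume (i : ℝ) (i + 1) :=
    fun h => ⟨h.1.ofReal, h.2.ofReal⟩
  have hftc : ∫ x in (i : ℝ)..(i + 1), f' (x ^ α) * ((α * x ^ (α - 1) : ℝ) : ℂ) = d := by
    refine intervalIntegral.integral_eq_sub_of_hasDerivAt_of_le
      (f := fun x : ℝ => f (x ^ α)) (by linarith) (hcf.comp hcpow).continuousOn (fun x hx => ?_)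
      ((ofReal_int hw).continuousOn_mul hcF.continuousOn)
    have hx0 : 0 < x := lt_of_le_of_lt hi hx.1
    have h := HasDerivAt.scomp x (hf (x ^ α)) (Real.hasDerivAt_rpow_const (p := α) (Or.inl hx0.ne'))
    rw [Complex.real_smul, mul_comm] at h
    exact h
  have hzero : ∫ x in (i : ℝ)..(i + 1),
      (d / (Δ : ℂ) - f' (x ^ α)) * ((α * x ^ (α - 1) : ℝ) : ℂ) = 0 := by
    simp only [sub_mul]
    rw [intervalIntegral.integral_sub ((ofReal_int hw).const_mul _)
      ((ofReal_int hw).continuousOn_mul hcF.continuousOn), hftc,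
      intervalIntegral.integral_const_mul, intervalIntegral.integral_ofReal,
      integral_rpow_cell hα i, div_mul_cancel₀ _ hΔ', sub_self]
  have hid : cellMean α i n • d -
      ∫ x in (i : ℝ)..(i + 1), f' (x ^ α) * ((α * x ^ (α - 1) * ((n : ℝ) - x) ^ (-α) : ℝ) : ℂ) =
      ∫ x in (i : ℝ)..(i + 1), (d / (Δ : ℂ) - f' (x ^ α)) *
        ((α * x ^ (α - 1) * ((n : ℝ) - x) ^ (-α) - c₀ * (α * x ^ (α - 1)) : ℝ) : ℂ) := by
    have h1 : ∫ x in (i : ℝ)..(i + 1), (d / (Δ : ℂ) - f' (x ^ α)) *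
        ((α * x ^ (α - 1) * ((n : ℝ) - x) ^ (-α) : ℝ) : ℂ) = cellMean α i n • d -
      ∫ x in (i : ℝ)..(i + 1), f' (x ^ α) *
        ((α * x ^ (α - 1) * ((n : ℝ) - x) ^ (-α) : ℝ) : ℂ) := by
      simp only [sub_mul]
      rw [intervalIntegral.integral_sub ((ofReal_int hk).const_mul _)
        ((ofReal_int hk).continuousOn_mul hcF.continuousOn),
        intervalIntegral.integral_const_mul, intervalIntegral.integral_ofReal,
        integral_kernel_cell hα hin, Complex.real_smul, Complex.ofReal_mul, ← hΔdef]
      congr 1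
      field_simp
    rw [← h1]
    have h2 : ∀ x : ℝ, (d / (Δ : ℂ) - f' (x ^ α)) *
        ((α * x ^ (α - 1) * ((n : ℝ) - x) ^ (-α) - c₀ * (α * x ^ (α - 1)) : ℝ) : ℂ) =
        (d / (Δ : ℂ) - f' (x ^ α)) * ((α * x ^ (α - 1) * ((n : ℝ) - x) ^ (-α) : ℝ) : ℂ) -
          c₀ * ((d / (Δ : ℂ) - f' (x ^ α)) * ((α * x ^ (α - 1) : ℝ) : ℂ)) := by
      intro x
      push_cast
      ring
    simp only [h2]
    rw [intervalIntegral.integral_sub ((ofReal_int hk).continuousOn_mul hcφ.continuousOn)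
      (((ofReal_int hw).continuousOn_mul hcφ.continuousOn).const_mul _),
      intervalIntegral.integral_const_mul, hzero, mul_zero, sub_zero]
  have hbound : IntervalIntegrable (fun x : ℝ => M * Δ *
      (α * x ^ (α - 1) * ((n : ℝ) - x) ^ (-α) - c₀ * (α * x ^ (α - 1))))
      MeasureTheory.volume (i : ℝ) (i + 1) := (hk.sub (hw.const_mul _)).const_mul _
  have hn : (i : ℝ) + 1 ≤ n := by exact_mod_cast hin
  rw [hid]
  refine (intervalIntegral.norm_integral_le_of_norm_le (by linarith) ?_ hbound).trans
    (le_of_eq ?_)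
  · -- at `x = n` the kernel takes the junk value `0 ^ (-α) = 0`, hence the exceptional point
    filter_upwards [MeasureTheory.compl_mem_ae_iff.2 (MeasureTheory.measure_singleton ((i : ℝ) + 1))]
      with x hx hxI
    have hx1 : x < i + 1 := lt_of_le_of_ne hxI.2 hx
    have hx0 : 0 < x := lt_of_le_of_lt hi hxI.1
    have hker : 0 ≤ α * x ^ (α - 1) * ((n : ℝ) - x) ^ (-α) - c₀ * (α * x ^ (α - 1)) := by
      have h1 : c₀ ≤ ((n : ℝ) - x) ^ (-α) :=
        Real.rpow_le_rpow_of_nonpos (by linarith) (by linarith [hxI.1]) (by linarith)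
      have h2 : 0 ≤ α * x ^ (α - 1) := by positivity
      nlinarith [mul_le_mul_of_nonneg_left h1 h2]
    rw [norm_mul, Complex.norm_of_nonneg hker]
    refine mul_le_mul_of_nonneg_right ?_ hker
    have h3 := norm_sub_sub_smul_le_of_norm_deriv_deriv_le hf hf' hM (y := x ^ α)
      ⟨Real.rpow_le_rpow hi hxI.1.le hα.le, Real.rpow_le_rpow hx0.le hx1.le hα.le⟩
    change ‖d - (Δ : ℂ) * f' (x ^ α)‖ ≤ M * Δ ^ 2 at h3
    have h4 : d / (Δ : ℂ) - f' (x ^ α) = (d - (Δ : ℂ) * f' (x ^ α)) / (Δ : ℂ) := by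
      field_simp
    rw [h4, norm_div, Complex.norm_of_nonneg hΔ.le, div_le_iff₀ hΔ]
    linarith
  · rw [intervalIntegral.integral_const_mul, intervalIntegral.integral_sub hk (hw.const_mul _),
      intervalIntegral.integral_const_mul, integral_kernel_cell hα hin, integral_rpow_cell hα i]
    ring

/-- The weights of the truncation error add up to order `n ^ (-q)`: cells away from `n`
contribute `n ^ (-1 - α)` each, cells close to `n` contribute a convergent series times
`n ^ (2 α - 2)`. -/
lemma exists_sum_powStep_sq_le (hα : 0 < α) (hα1 : α < 1) {q : ℝ} (hq : 0 ≤ q) (hqα : q ≤ α)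
    (hqα1 : q ≤ 1 - α) :
    ∃ C : ℝ, 0 < C ∧ ∀ n : ℕ, 1 ≤ n →
      ∑ i ∈ Finset.range n, powStep α i ^ 2 * (cellMean α i n - ((n : ℝ) - i) ^ (-α)) ≤
        C * (n : ℝ) ^ (-q) := by
  obtain ⟨A, hA, hAle⟩ := exists_cellMean_le hα hα1
  have hsummable : Summable fun k : ℕ => ((k : ℝ) + 1) ^ (-α - 1) := by
    have h := (Real.summable_nat_rpow (p := -α - 1)).2 (by linarith)
    simpa using (summable_nat_add_iff 1).2 h
  set Z := ∑' k : ℕ, ((k : ℝ) + 1) ^ (-α - 1) with hZ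
  have hZ0 : 0 ≤ Z := tsum_nonneg fun k => by positivity
  refine ⟨A * (4 * (1 + Z)), by positivity, fun n hn => ?_⟩
  have hn0 : (0 : ℝ) < n := by exact_mod_cast hn
  set S : ℝ := (n : ℝ) + 1 with hS
  have hS1 : 1 ≤ S := by linarith
  have hterm : ∀ i ∈ Finset.range n,
      powStep α i ^ 2 * (cellMean α i n - ((n : ℝ) - i) ^ (-α)) ≤
        A * (4 * S ^ (-q) * (S⁻¹ + ((n : ℝ) - i) ^ (-α - 1))) := by
    intro i hi
    have hin := Finset.mem_range.1 hi
    have hin' : (i : ℝ) + 1 ≤ n := by exact_mod_cast hin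
    have hi0 : (0 : ℝ) ≤ i := by positivity
    set y : ℝ := (n : ℝ) - i with hy
    have hy1 : 1 ≤ y := by linarith
    have hyp : 0 < y ^ (-α - 1) := Real.rpow_pos_of_pos (by linarith) _
    have hSq : 0 < S ^ (-q) := Real.rpow_pos_of_pos (by linarith) _
    have h1 : cellMean α i n - y ^ (-α) ≤ A * y ^ (-α - 1) := by linarith [hAle i n hin]
    have h2 : powStep α i ^ 2 ≤ ((i : ℝ) + 1) ^ (2 * α - 2) := by
      calc powStep α i ^ 2 ≤ (((i : ℝ) + 1) ^ (α - 1)) ^ 2 :=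
            pow_le_pow_left₀ (powStep_pos hα i).le (powStep_le hα1.le i) 2
        _ = ((i : ℝ) + 1) ^ (2 * α - 2) := by
            rw [← Real.rpow_natCast, ← Real.rpow_mul (by positivity)]
            ring_nf
    have h3 : ((i : ℝ) + 1) ^ (2 * α - 2) * y ^ (-α - 1) ≤
        4 * S ^ (-q) * (S⁻¹ + y ^ (-α - 1)) := by
      rcases le_total ((i : ℝ) + 1) y with hle | hle
      · have h4 : ((i : ℝ) + 1) ^ (2 * α - 2) ≤ 1 :=
          Real.rpow_le_one_of_one_le_of_nonpos (by linarith) (by linarith)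
        have h5 : y ^ (-(1 + α)) ≤ 2 ^ (1 + α) * S ^ (-(1 + α)) :=
          rpow_neg_le_of_half_le (by linarith) (by linarith) (by linarith)
        have h6 : (2 : ℝ) ^ (1 + α) ≤ 4 := by
          calc (2 : ℝ) ^ (1 + α) ≤ 2 ^ (2 : ℝ) :=
                Real.rpow_le_rpow_of_exponent_le (by norm_num) (by linarith)
            _ = 4 := by norm_num
        have h7 : S ^ (-(1 + α)) ≤ S ^ (-q) * S⁻¹ := by
          rw [← Real.rpow_neg_one, ← Real.rpow_add (by linarith)]
          exact Real.rpow_le_rpow_of_exponent_le hS1 (by linarith)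
        rw [show -(1 + α) = -α - 1 by ring] at h5 h7
        have h8 : 0 ≤ S ^ (-α - 1) := Real.rpow_nonneg (by linarith) _
        nlinarith [mul_le_mul_of_nonneg_right h4 hyp.le, mul_le_mul_of_nonneg_right h6 h8,
          mul_pos hSq hyp]
      · have h4 : ((i : ℝ) + 1) ^ (2 * α - 2) ≤ ((i : ℝ) + 1) ^ (-q) :=
          Real.rpow_le_rpow_of_exponent_le (by linarith) (by linarith)
        have h5 : ((i : ℝ) + 1) ^ (-q) ≤ 2 ^ q * S ^ (-q) :=
          rpow_neg_le_of_half_le hq (by linarith) (by linarith)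
        have h6 : (2 : ℝ) ^ q ≤ 4 := by
          calc (2 : ℝ) ^ q ≤ 2 ^ (2 : ℝ) :=
                Real.rpow_le_rpow_of_exponent_le (by norm_num) (by linarith)
            _ = 4 := by norm_num
        have h7 : ((i : ℝ) + 1) ^ (2 * α - 2) ≤ 4 * S ^ (-q) := by
          nlinarith [mul_le_mul_of_nonneg_right h6 hSq.le]
        have h8 : 0 ≤ S⁻¹ := by positivity
        nlinarith [mul_le_mul_of_nonneg_right h7 hyp.le, mul_nonneg hSq.le h8]
    calc powStep α i ^ 2 * (cellMean α i n - y ^ (-α))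
        ≤ powStep α i ^ 2 * (A * y ^ (-α - 1)) := by gcongr
      _ ≤ ((i : ℝ) + 1) ^ (2 * α - 2) * (A * y ^ (-α - 1)) := by gcongr
      _ = A * (((i : ℝ) + 1) ^ (2 * α - 2) * y ^ (-α - 1)) := by ring
      _ ≤ A * (4 * S ^ (-q) * (S⁻¹ + y ^ (-α - 1))) := by gcongr
  refine (Finset.sum_le_sum hterm).trans ?_
  rw [← Finset.mul_sum, ← Finset.mul_sum, Finset.sum_add_distrib]
  have hs1 : ∑ _i ∈ Finset.range n, S⁻¹ ≤ 1 := by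
    rw [Finset.sum_const, Finset.card_range, nsmul_eq_mul, ← div_eq_mul_inv,
      div_le_one (by linarith)]
    linarith
  have hs2 : ∑ i ∈ Finset.range n, ((n : ℝ) - i) ^ (-α - 1) ≤ Z := by
    refine le_trans (le_of_eq ?_) (hsummable.sum_le_tsum (Finset.range n)
      fun k _ => by positivity)
    rw [← Finset.sum_range_reflect (fun i : ℕ => ((i : ℝ) + 1) ^ (-α - 1)) n]
    refine Finset.sum_congr rfl fun i hi => ?_
    have hi' : i + 1 ≤ n := Finset.mem_range.1 hi
    rw [show n - 1 - i = n - (i + 1) by omega, Nat.cast_sub hi']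
    push_cast
    ring_nf
  have hs3 : S ^ (-q) ≤ (n : ℝ) ^ (-q) :=
    Real.rpow_le_rpow_of_nonpos hn0 (by linarith) (by linarith)
  calc A * (4 * S ^ (-q) * (∑ _i ∈ Finset.range n, S⁻¹ +
        ∑ i ∈ Finset.range n, ((n : ℝ) - i) ^ (-α - 1)))
      ≤ A * (4 * (n : ℝ) ^ (-q) * (1 + Z)) := by
        refine mul_le_mul_of_nonneg_left ?_ hA.le
        refine (mul_le_mul_of_nonneg_left (add_le_add hs1 hs2)
          (mul_nonneg (by norm_num) (Real.rpow_nonneg (by linarith) _))).trans ?_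
        gcongr
    _ = A * (4 * (1 + Z)) * (n : ℝ) ^ (-q) := by ring

/-- Consistency of the scheme at the samples of `E_α(μ x ^ α)`. -/
lemma exists_norm_truncation_le (hα : 0 < α) (hα1 : α < 1) {q : ℝ} (hq : 0 ≤ q) (hqα : q ≤ α)
    (hqα1 : q ≤ 1 - α) :
    ∃ C : ℝ, 0 < C ∧ ∀ (μ : ℂ) (M : ℝ) (n : ℕ), 1 ≤ n →
      (∀ t ∈ Set.Icc 0 ((n : ℝ) ^ α), ‖deriv (deriv (mittagLeffler α)) (μ * t)‖ ≤ M) →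
      ‖discreteCaputo α (fun j => mittagLeffler α (μ * (((j : ℝ) ^ α : ℝ) : ℂ))) n -
          Real.Gamma (1 - α) * μ * mittagLeffler α (μ * (((n : ℝ) ^ α : ℝ) : ℂ))‖ ≤
        C * M * ‖μ‖ ^ 2 * (n : ℝ) ^ (-q) := by
  obtain ⟨C, hC, hCle⟩ := exists_sum_powStep_sq_le hα hα1 hq hqα hqα1
  refine ⟨C, hC, fun μ M n hn hM => ?_⟩
  have hn0 : (0 : ℝ) < n := by exact_mod_cast hn
  have hM0 : 0 ≤ M := (norm_nonneg _).trans (hM 0 ⟨le_rfl, by positivity⟩)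
  have hd := differentiable_mittagLeffler hα
  have hd' : Differentiable ℂ (deriv (mittagLeffler α)) :=
    hd.contDiff.differentiable_deriv_two
  have hray : ∀ {h : ℂ → ℂ}, Differentiable ℂ h → ∀ t : ℝ,
      HasDerivAt (fun t : ℝ => h (μ * t)) (μ * deriv h (μ * t)) t := by
    intro h hh t
    have h1 : HasDerivAt (fun z : ℂ => h (μ * z)) (deriv h (μ * t) * μ) (t : ℂ) := by
      have h2 : HasDerivAt (fun z : ℂ => μ * z) μ (t : ℂ) := by
        simpa using (hasDerivAt_id (t : ℂ)).const_mul μ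
      exact (hh (μ * t)).hasDerivAt.comp (t : ℂ) h2
    rw [mul_comm]
    exact h1.comp_ofReal
  have hint : ∀ k < n, IntervalIntegrable (fun x : ℝ =>
      μ * deriv (mittagLeffler α) (μ * ((x ^ α : ℝ) : ℂ)) *
        ((α * x ^ (α - 1) * ((n : ℝ) - x) ^ (-α) : ℝ) : ℂ)) MeasureTheory.volume
      ((k : ℕ) : ℝ) ((k + 1 : ℕ) : ℝ) := by
    intro k hk
    have h1 := (intervalIntegrable_kernel_cell (s := α - 1) (by linarith) hα1 hk).const_mul α
    simp only [← mul_assoc] at h1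
    push_cast
    have h2 : IntervalIntegrable (fun x : ℝ =>
        (((α * x ^ (α - 1) * ((n : ℝ) - x) ^ (-α) : ℝ)) : ℂ)) MeasureTheory.volume
        (k : ℝ) (k + 1) := ⟨h1.1.ofReal, h1.2.ofReal⟩
    push_cast at h2
    refine h2.continuousOn_mul (Continuous.continuousOn ?_)
    have hc := hd'.continuous
    have hp : Continuous fun x : ℝ => x ^ α := Real.continuous_rpow_const hα.le
    fun_prop
  have hcaputo := integral_deriv_mittagLeffler hα hα1 μ hn0
  have hsplit := intervalIntegral.sum_integral_adjacent_intervals (a := fun k : ℕ => (k : ℝ)) hint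
  simp only [Nat.cast_zero] at hsplit
  rw [← hcaputo, ← hsplit, discreteCaputo, ← Finset.sum_sub_distrib]
  refine (norm_sum_le _ _).trans ?_
  calc _ ≤ ∑ i ∈ Finset.range n, (‖μ‖ ^ 2 * M) *
        (powStep α i ^ 2 * (cellMean α i n - ((n : ℝ) - i) ^ (-α))) := by
        refine Finset.sum_le_sum fun i hi => ?_
        have hin := Finset.mem_range.1 hi
        have hin' : (i : ℝ) + 1 ≤ n := by exact_mod_cast hin
        have h := norm_cell_error_le hα hα1 (f := fun t : ℝ => mittagLeffler α (μ * t))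
          (f' := fun t : ℝ => μ * deriv (mittagLeffler α) (μ * t))
          (f'' := fun t : ℝ => μ * (μ * deriv (deriv (mittagLeffler α)) (μ * t)))
          (hray hd) (fun t => (hray hd' t).const_mul μ) hin (M := ‖μ‖ ^ 2 * M)
          (fun t ht => by
            rw [norm_mul, norm_mul, ← mul_assoc, ← sq]
            refine mul_le_mul_of_nonneg_left (hM t ⟨?_, ?_⟩) (by positivity)
            · exact le_trans (by positivity) ht.1
            · exact ht.2.trans (Real.rpow_le_rpow (by positivity) hin' hα.le))
        push_cast at h ⊢
        rw [mul_assoc (‖μ‖ ^ 2 * M)] at h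
        exact h
    _ ≤ (‖μ‖ ^ 2 * M) * (C * (n : ℝ) ^ (-q)) := by
        rw [← Finset.mul_sum]
        gcongr
        exact hCle n hn
    _ = C * M * ‖μ‖ ^ 2 * (n : ℝ) ^ (-q) := by ring

end

/-! ### Bounds for the Mittag-Leffler function on a sector -/

section
variable {α : ℝ}

lemma exists_norm_le_of_differentiable {h : ℂ → ℂ} (hh : Differentiable ℂ h) (r : ℝ) :
    ∃ M : ℝ, ∀ z : ℂ, ‖z‖ ≤ r → ‖h z‖ ≤ M := by
  obtain ⟨M, hM⟩ := (isCompact_closedBall (0 : ℂ) r).exists_bound_of_continuousOn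
    hh.continuous.continuousOn
  exact ⟨M, fun z hz => hM z (mem_closedBall_zero_iff.2 hz)⟩

/-- The samples of `E_α(z x ^ α)` on `N` cells of `[0, 1]` solve the scheme up to a residual that
vanishes as `N → ∞`, so that `|E_α(z)|` inherits the contractivity of the scheme. -/
lemma norm_mittagLeffler_le_one (hα : 0 < α) (hα1 : α < 1) {z : ℂ} (hz : z.re < 0) :
    ‖mittagLeffler α z‖ ≤ 1 := by
  obtain ⟨C, hC, hstab⟩ := exists_norm_le_of_residual hα hα1 (q := 0) le_rfl hα.le
  obtain ⟨A, hA, htrunc⟩ := exists_norm_truncation_le hα hα1 (q := 0) le_rfl hα.le (by linarith)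
  have hd' : Differentiable ℂ (deriv (mittagLeffler α)) :=
    (differentiable_mittagLeffler hα).contDiff.differentiable_deriv_two
  have hd'' : Differentiable ℂ (deriv (deriv (mittagLeffler α))) :=
    hd'.contDiff.differentiable_deriv_two
  obtain ⟨M, hM⟩ := exists_norm_le_of_differentiable hd'' ‖z‖
  have hM0 : 0 ≤ M := (norm_nonneg _).trans (hM z le_rfl)
  have hΓ : 0 < Real.Gamma (1 - α) := Real.Gamma_pos_of_pos (by linarith)
  set K₀ : ℝ := A * M * ‖z‖ ^ 2 / (Real.Gamma (1 - α) * -z.re) with hK₀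
  have hz' : 0 < -z.re := by linarith
  have hbound : ∀ N : ℕ, 1 ≤ N → ‖mittagLeffler α z‖ ≤ 1 + C * (K₀ * (N : ℝ) ^ (-α)) := by
    intro N hN
    have hN0 : (0 : ℝ) < N := by exact_mod_cast hN
    set p : ℝ := (N : ℝ) ^ (-α) with hp
    have hp0 : 0 < p := by positivity
    have hpN : p * (N : ℝ) ^ α = 1 := by
      rw [hp, ← Real.rpow_add hN0, neg_add_cancel, Real.rpow_zero]
    have h := hstab N (fun j => mittagLeffler α (z * p * (((j : ℝ) ^ α : ℝ) : ℂ)))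
      (Real.Gamma (1 - α) * (z * p)) (K₀ * p) ?_ (by positivity) (fun n hn hnN => ?_) N hN le_rfl
    · have e : z * p * (((N : ℝ) ^ α : ℝ) : ℂ) = z := by
        rw [mul_assoc, ← Complex.ofReal_mul, hpN, Complex.ofReal_one, mul_one]
      simp only [e] at h
      simpa [Real.zero_rpow hα.ne', mittagLeffler_zero] using h
    · rw [Complex.re_ofReal_mul, Complex.re_mul_ofReal]
      nlinarith [mul_pos hΓ (mul_pos hz' hp0)]
    · refine (htrunc (z * p) M n hn fun t ht => hM _ ?_).trans (le_of_eq ?_)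
      · rw [norm_mul, norm_mul, Complex.norm_of_nonneg hp0.le, Complex.norm_of_nonneg ht.1]
        have hnN' : (n : ℝ) ^ α ≤ (N : ℝ) ^ α := by gcongr
        have h1 : p * t ≤ 1 := by
          rw [← hpN]
          exact mul_le_mul_of_nonneg_left (ht.2.trans hnN') hp0.le
        calc ‖z‖ * p * t = ‖z‖ * (p * t) := by ring
          _ ≤ ‖z‖ := mul_le_of_le_one_right (norm_nonneg _) h1
      · rw [Complex.re_ofReal_mul, Complex.re_mul_ofReal, norm_mul,
          Complex.norm_of_nonneg hp0.le, hK₀]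
        have hz0 := hz.ne
        field_simp
  have hlim : Filter.Tendsto (fun N : ℕ => 1 + C * (K₀ * (N : ℝ) ^ (-α))) Filter.atTop
      (nhds (1 + C * (K₀ * 0))) :=
    ((((tendsto_rpow_neg_atTop hα).comp tendsto_natCast_atTop_atTop).const_mul K₀).const_mul
      C).const_add 1
  rw [mul_zero, mul_zero, add_zero] at hlim
  exact ge_of_tendsto hlim (Filter.eventually_atTop.2 ⟨1, hbound⟩)

lemma exists_norm_deriv_deriv_mittagLeffler_le (hα : 0 < α) (hα1 : α < 1) {c : ℝ} (hc : 0 < c) :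
    ∃ M : ℝ, 0 < M ∧ ∀ z : ℂ, c * ‖z‖ ≤ -z.re →
      ‖deriv (deriv (mittagLeffler α)) z‖ ≤ M := by
  have hd := differentiable_mittagLeffler hα
  obtain ⟨A, hA⟩ := exists_norm_le_of_differentiable hd (1 + c / 2)
  refine ⟨2 * max A 1 / (c / 2) ^ 2, by positivity, fun z hz => ?_⟩
  have h := Complex.norm_iteratedDeriv_le_of_forall_mem_sphere_norm_le (c := z) (R := c / 2)
    (C := max A 1) 2 (by positivity) hd.diffContOnCl (fun w hw => ?_)
  · simpa [iteratedDeriv_succ, iteratedDeriv_zero] using h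
  · have hwz : ‖w - z‖ = c / 2 := mem_sphere_iff_norm.1 hw
    rcases le_total ‖z‖ 1 with h1 | h1
    · refine (hA w ?_).trans (le_max_left _ _)
      calc ‖w‖ = ‖z + (w - z)‖ := by rw [add_sub_cancel]
        _ ≤ ‖z‖ + ‖w - z‖ := norm_add_le _ _
        _ ≤ 1 + c / 2 := by rw [hwz]; linarith
    · refine (norm_mittagLeffler_le_one hα hα1 ?_).trans (le_max_right _ _)
      have h2 : (w - z).re ≤ c / 2 := hwz ▸ Complex.re_le_norm (w - z)
      rw [Complex.sub_re] at h2
      nlinarith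

lemma cos_mul_norm_le_neg_re_of_mem_negClosedSector {φ : ℝ} (hφ : φ ≤ Real.pi) {z : ℂ}
    (hz : z ∈ negClosedSector φ) : Real.cos φ * ‖z‖ ≤ -z.re := by
  have hclosed : IsClosed {ζ : ℂ | Real.cos φ * ‖ζ‖ ≤ ζ.re} :=
    isClosed_le (by fun_prop) Complex.continuous_re
  have hsub : openSector φ ⊆ {ζ : ℂ | Real.cos φ * ‖ζ‖ ≤ ζ.re} := by
    rintro ζ ⟨-, hζ⟩
    have h1 : Real.cos φ ≤ Real.cos ζ.arg := by
      rw [← Real.cos_abs ζ.arg]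
      exact Real.cos_le_cos_of_nonneg_of_le_pi (abs_nonneg _) hφ hζ.le
    change Real.cos φ * ‖ζ‖ ≤ ζ.re
    rw [← Complex.norm_mul_cos_arg ζ, mul_comm]
    gcongr
  have h := closure_minimal hsub hclosed hz
  simpa using h

/-! ### The error estimate -/

lemma rateExponent_le_min {ε : ℝ} (hε : 0 < ε) :
    rateExponent α ε ≤ min α (1 - α) := by
  rw [rateExponent]
  split_ifs with h
  · exact le_min le_rfl (by linarith)
  · exact le_min (by linarith) (by linarith)

/-- The scheme with step `Δt` for `lam` is the scheme with step one for `lam * Δt ^ α`. -/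
lemma IsSchemeSolution.discreteCaputo_eq (hα : 0 < α) (hα1 : α < 1) {Δt : ℝ} (hΔt : 0 < Δt)
    {N : ℕ} {lam : ℂ} {v : ℕ → ℂ} (hv : IsSchemeSolution α Δt N lam v) {n : ℕ} (hn : 1 ≤ n)
    (hnN : n ≤ N) :
    discreteCaputo α v n = Real.Gamma (1 - α) * (lam * ((Δt ^ α : ℝ) : ℂ)) * v n := by
  have hΓ : (Real.Gamma (1 - α) : ℂ) ≠ 0 :=
    Complex.ofReal_ne_zero.2 (Real.Gamma_pos_of_pos (by linarith)).ne'
  have hd : ((Δt ^ α : ℝ) : ℂ) ≠ 0 := Complex.ofReal_ne_zero.2 (by positivity)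
  have h := hv.2 n hn hnN
  rw [← Finset.sum_div, sum_schemeCoeff_mul hα v hn, sub_eq_zero, div_eq_iff hd,
    Complex.real_smul, Complex.ofReal_inv, inv_mul_eq_iff_eq_mul₀ hΓ] at h
  rw [h]
  ring

end

theorem lemma3p3 (α φ₀ ε : ℝ) (hα : 0 < α) (hα1 : α < 1) (hφ : 0 < φ₀) (hφ1 : φ₀ < Real.pi / 2)
    (hε : 0 < ε) :
    ∃ C : ℝ, 0 < C ∧
      ∀ (T : ℝ) (N : ℕ) (lam : ℂ) (v : ℕ → ℂ) (Δt : ℝ),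
        0 < T → 1 ≤ N → Δt = T / (N : ℝ) → lam ∈ negClosedSector φ₀ →
        IsSchemeSolution α Δt N lam v →
        ∀ n : ℕ, 1 ≤ n → n ≤ N →
          ‖v n - mittagLeffler α (lam * ((((n : ℝ) * Δt) ^ α : ℝ) : ℂ))‖ ≤
            C * ‖lam‖ * Δt ^ α * (1 + ‖lam‖ * Δt ^ α) / (n : ℝ) ^ rateExponent α ε := by
  have hq : 0 ≤ min α (1 - α) := le_min hα.le (by linarith)
  have hqα := min_le_left α (1 - α)
  have hqα1 := min_le_right α (1 - α)
  have hs : rateExponent α ε ≤ min α (1 - α) := rateExponent_le_min hε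
  set q := min α (1 - α)
  obtain ⟨C, hC, hstab⟩ := exists_norm_le_of_residual hα hα1 hq hqα
  obtain ⟨A, hA, htrunc⟩ := exists_norm_truncation_le hα hα1 hq hqα hqα1
  have hcos : 0 < Real.cos φ₀ := Real.cos_pos_of_mem_Ioo ⟨by linarith, hφ1⟩
  obtain ⟨M, hM, hMle⟩ := exists_norm_deriv_deriv_mittagLeffler_le hα hα1 hcos
  have hΓ : 0 < Real.Gamma (1 - α) := Real.Gamma_pos_of_pos (by linarith)
  set G := Real.Gamma (1 - α) with hG
  refine ⟨C * (A * M / (G * Real.cos φ₀)), by positivity, ?_⟩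
  intro T N lam v Δt hT hN hΔt hlam hv n hn hnN
  have hN0 : (0 : ℝ) < N := by exact_mod_cast hN
  have hn0 : (0 : ℝ) < n := by exact_mod_cast hn
  have hn1 : (1 : ℝ) ≤ n := by exact_mod_cast hn
  have hΔ0 : 0 < Δt := by rw [hΔt]; positivity
  have hd0 : 0 < Δt ^ α := by positivity
  have hsec := cos_mul_norm_le_neg_re_of_mem_negClosedSector (by linarith) hlam
  set μ : ℂ := lam * ((Δt ^ α : ℝ) : ℂ) with hμ
  have hμnorm : ‖μ‖ = ‖lam‖ * Δt ^ α := by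
    rw [hμ, norm_mul, Complex.norm_of_nonneg hd0.le]
  have hμsec : Real.cos φ₀ * ‖μ‖ ≤ -μ.re := by
    rw [hμnorm, hμ, Complex.re_mul_ofReal]
    nlinarith [mul_le_mul_of_nonneg_right hsec hd0.le]
  have hμre : μ.re ≤ 0 := by
    nlinarith [mul_nonneg hcos.le (norm_nonneg μ)]
  have hray : ∀ t : ℝ, 0 ≤ t → Real.cos φ₀ * ‖μ * t‖ ≤ -(μ * t).re := by
    intro t ht
    rw [norm_mul, Complex.norm_of_nonneg ht, Complex.re_mul_ofReal]
    nlinarith [mul_le_mul_of_nonneg_right hμsec ht]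
  have h := hstab N (fun j => v j - mittagLeffler α (μ * (((j : ℝ) ^ α : ℝ) : ℂ)))
    (G * μ) (A * M * ‖μ‖ / (G * Real.cos φ₀)) ?_ (by positivity) (fun k hk hkN => ?_) n hn hnN
  · have e : lam * ((((n : ℝ) * Δt) ^ α : ℝ) : ℂ) = μ * (((n : ℝ) ^ α : ℝ) : ℂ) := by
      rw [Real.mul_rpow hn0.le hΔ0.le, hμ]
      push_cast
      ring
    have h0 : ‖v 0 - mittagLeffler α (μ * ((((0 : ℕ) : ℝ) ^ α : ℝ) : ℂ))‖ = 0 := by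
      simp [Real.zero_rpow hα.ne', mittagLeffler_zero, hv.1]
    rw [e]
    refine h.trans ?_
    simp only [h0, zero_add]
    have hrate : (n : ℝ) ^ (-q) ≤ ((n : ℝ) ^ rateExponent α ε)⁻¹ := by
      rw [← Real.rpow_neg hn0.le]
      exact Real.rpow_le_rpow_of_exponent_le hn1 (by linarith)
    rw [hμnorm, div_eq_mul_inv _ ((n : ℝ) ^ rateExponent α ε)]
    have hx : 0 ≤ ‖lam‖ * Δt ^ α := by positivity
    calc C * (A * M * (‖lam‖ * Δt ^ α) / (G * Real.cos φ₀)) * (n : ℝ) ^ (-q)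
        ≤ C * (A * M * (‖lam‖ * Δt ^ α) / (G * Real.cos φ₀)) *
            ((n : ℝ) ^ rateExponent α ε)⁻¹ := by gcongr
      _ = C * (A * M / (G * Real.cos φ₀)) * ‖lam‖ * Δt ^ α * 1 *
            ((n : ℝ) ^ rateExponent α ε)⁻¹ := by ring
      _ ≤ C * (A * M / (G * Real.cos φ₀)) * ‖lam‖ * Δt ^ α * (1 + ‖lam‖ * Δt ^ α) *
            ((n : ℝ) ^ rateExponent α ε)⁻¹ := by
          gcongr
          linarith
  · rw [Complex.re_ofReal_mul]
    nlinarith [mul_nonneg hΓ.le (neg_nonneg.2 hμre)]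
  · have htr := htrunc μ M k hk fun t ht => hMle _ (hray t ht.1)
    have hvk := hv.discreteCaputo_eq hα hα1 hΔ0 hk hkN
    rw [← hμ, ← hG] at hvk
    rw [discreteCaputo_sub, hvk]
    have e : G * μ * v k - discreteCaputo α
          (fun j => mittagLeffler α (μ * (((j : ℝ) ^ α : ℝ) : ℂ))) k -
          G * μ * (v k - mittagLeffler α (μ * (((k : ℝ) ^ α : ℝ) : ℂ))) =
        -(discreteCaputo α (fun j => mittagLeffler α (μ * (((j : ℝ) ^ α : ℝ) : ℂ))) k -
          G * μ * mittagLeffler α (μ * (((k : ℝ) ^ α : ℝ) : ℂ))) := by ring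
    rw [e, norm_neg]
    refine htr.trans (mul_le_mul_of_nonneg_right ?_ (by positivity))
    rw [Complex.re_ofReal_mul]
    calc A * M * ‖μ‖ ^ 2 = A * M * ‖μ‖ / (G * Real.cos φ₀) * (G * (Real.cos φ₀ * ‖μ‖)) := by
          field_simp
      _ ≤ A * M * ‖μ‖ / (G * Real.cos φ₀) * (G * -μ.re) := by gcongr
      _ = A * M * ‖μ‖ / (G * Real.cos φ₀) * -(G * μ.re) := by ring
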